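/- Let $\Gamma$ be a finite, undirected, connected graph without loops or multiple edges, with vertex set $X$, path-length distance $\partial$ and diameter $D\ge 3$. Write $\Gamma_i(x)=\{y\in X:\partial(x,y)=i\}$ and $\Gamma(x)=\Gamma_1(x)$. Assume that $\Gamma$ is distance-regular: for $0\le h,i,j\le D$ the number $p^h_{i,j}=|\Gamma_i(x)\cap\Gamma_j(y)|$ is the same for all $x,y$ with $\partial(x,y)=h$. Put $c_i=p^i_{1,i-1}$, $a_i=p^i_{1,i}$, $b_i=p^i_{1,i+1}$, $k_i=p^0_{i,i}$, and assume that the valency $k=k_1$ is at least $3$. Let $A_i$ be the distance matrices, $(A_i)_{x,y}=1$ if $\partial(x,y)=i$ and $0$ otherwise; they span the Bose–Mesner algebra $M\subseteq \mathrm{Mat}_X(\mathbb R)$. An ordering of the primitive idempotents is a basis $E_0=|X|^{-1}J,E_1,\dots,E_D$ of $M$ ($J$ the all-ones matrix) with $\sum_i E_i=I$, $E_i^t=E_i$, $E_iE_j=\delta_{i,j}E_i$. Its Krein parameters $q^h_{i,j}$ are given by $E_i\circ E_j=|X|^{-1}\sum_h q^h_{i,j}E_h$ (entrywise product). The ordering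 is $Q$-polynomial if $q^h_{i,j}=0$ whenever one of $h,i,j$ is greater than the sum of the other two and $q^h_{i,j}\neq 0$ whenever one of $h,i,j$ equals the sum of the other two. Let $E$ be a $Q$-polynomial primitive idempotent, i.e. $E=E_1$ for some $Q$-polynomial ordering. Write $E=|X|^{-1}\sum_{i=0}^D\theta^*_iA_i$. *Kites.* For $2\le i\le D$ and $\partial(x,y)=i$, $\partial(x,z)=1$, $\partial(y,z)=i-1$, let $\zeta_i(x,y,z)=|\Gamma(x)\cap\Gamma_{i-1}(y)\cap\Gamma(z)|$. Let $\zeta_i(x,y,*)$ be the average of $\zeta_i(x,y,z)$ over $z\in\Gamma(x)\cap\Gamma_{i-1}(y)$ and let $\zeta_i(*,y,z)$ be the average of $\zeta_i(x,y,z)$ over $x\in\Gamma_i(y)\cap\Gamma(z)$. The graph $\Gamma$ is *reinforced* if for $2\le i\le D$ the number $\zeta_i(x,y,*)$ is the same for all $x,y$ with $\partial(x,y)=i$, and $\zeta_i(*,y,z)$ is the same for all $y,z$ with $\partial(y,z)=i-1$. An $i$-kite is a 4-tuple $(x,y,z,w)$ of vertices with $\partial(x,y)=i$, $\partial(x,z)=\partial(x,w)=\partial(z,w)=1$,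 $\partial(y,z)=\partial(y,w)=i-1$, and the $i$th kite number $z_i$ is the number of $i$-kites divided by $|X|k_ic_i$. *The polynomials $\Phi_i$.* Let $\beta+1$ be the common value of $(\theta^*_{i-2}-\theta^*_{i+1})/(\theta^*_{i-1}-\theta^*_i)$ for $2\le i\le D-1$, and $\gamma^*$ the common value of $\theta^*_{i-1}-\beta\theta^*_i+\theta^*_{i+1}$ for $1\le i\le D-1$ (it is well known that these do not depend on $i$). For $2\le i\le D$ put $$\alpha_i=\frac{(\theta^*_1-\theta^*_2)(\theta^*_0+\theta^*_1-\theta^*_{i-1}-\theta^*_i)}{(\theta^*_0-\theta^*_2)(\theta^*_{i-1}-\theta^*_i)},\qquad \beta_i=\frac{(\theta^*_0-\theta^*_1)(\theta^*_2-\theta^*_i)-(\theta^*_1-\theta^*_2)(\theta^*_1-\theta^*_{i-1})}{(\theta^*_0-\theta^*_2)(\theta^*_{i-1}-\theta^*_i)}.$$ For $2\le i\le D-1$ put $$r_i=c_i\frac{\theta^*_0\theta^*_1-\theta^*_{i-1}\theta^*_i}{\theta^{*2}_0-\theta^{*2}_i},\quad s_i=c_i\frac{\theta^*_0\theta^*_{i-1}-\theta^*_1\theta^*_i}{\theta^{*2}_0-\theta^{*2}_i},\quad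 R_i=b_i\frac{\theta^*_0\theta^*_1-\theta^*_{i+1}\theta^*_i}{\theta^{*2}_0-\theta^{*2}_i},\quad S_i=b_i\frac{\theta^*_0\theta^*_{i+1}-\theta^*_1\theta^*_i}{\theta^{*2}_0-\theta^{*2}_i},$$ $$z^-_i=\frac{r_i\theta^*_1+s_i\theta^*_{i-1}-\theta^*_0-(c_i-1)\theta^*_2}{\theta^*_1-\theta^*_2},\qquad z^+_{i+1}=\frac{\theta^*_0+a_1\theta^*_1+(b_i-1-a_1)\theta^*_2-R_i\theta^*_1-S_i\theta^*_{i+1}}{\theta^*_1-\theta^*_2},$$ and $\Phi_i(\lambda)=u_i\lambda^2+v_i\lambda+w_i$, where $u_i=-\alpha_i\alpha_{i+1}$, $v_i=\alpha_i(z^+_{i+1}-a_1\beta_{i+1})-\alpha_{i+1}(a_1\beta_i-z^-_i)$ and $$w_i=(a_1\beta_i-z^-_i)(z^+_{i+1}-a_1\beta_{i+1})-c_ib_i\Bigl(\frac{\gamma^*}{\theta^*_1-\theta^*_2}\,\frac{\theta^*_i-\theta^*_1}{\theta^*_i+\theta^*_0}\Bigr)^2 .$$ *Vectors.* Let $\hat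 x\in\mathbb R^X$ be the standard basis vector of $x\in X$. For $x,y\in X$ with $\partial(x,y)=i$ let $x^-_y=\sum_{z\in\Gamma(x)\cap\Gamma_{i-1}(y)}\hat z$ and $x^+_y=\sum_{z\in\Gamma(x)\cap\Gamma_{i+1}(y)}\hat z$. **Proposition.** Assume that $\Gamma$ is reinforced. Then for $2\le i\le D-1$ we have $\Phi_i(z_2)\ge 0$. Moreover, for each such $i$ the following are equivalent: (i) $\Phi_i(z_2)=0$; (ii) for all $x,y\in X$ with $\partial(x,y)=i$ the vectors $Ex^-_y$, $Ex^+_y$, $E\hat x$, $E\hat y$ are linearly dependent; (iii) there exist $x,y\in X$ with $\partial(x,y)=i$ such that $Ex^-_y$, $Ex^+_y$, $E\hat x$, $E\hat y$ are linearly dependent. -/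

import Mathlib

open scoped Matrix

noncomputable section

namespace DistanceRegular

variable {X : Type*} [Fintype X]

/-- `Γ_i(x) ∩ Γ_j(y)`: the vertices at distance `i` from `x` and at distance `j` from `y`. -/
def meet (G : SimpleGraph X) (i j : ℕ) (x y : X) : Finset X :=
  Finset.univ.filter fun z => G.dist x z = i ∧ G.dist y z = j

/-- A finite connected graph is distance-regular if `|Γ_i(x) ∩ Γ_j(y)|` depends only on `i`, `j`
and the distance of `x` and `y`. (For `i` or `j` above the diameter the set is empty.) -/
def IsDistanceRegular (G : SimpleGraph X) : Prop :=
  G.Connected ∧ ∀ i j : ℕ, ∀ x y x' y' : X, G.dist x y = G.dist x' y' →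
    (meet G i j x y).card = (meet G i j x' y').card

open Classical in
/-- The intersection number `p^h_{i,j} = |Γ_i(x) ∩ Γ_j(y)|`, where `x, y` are any vertices at
distance `h`; it is `0` if there are none. -/
def interNum (G : SimpleGraph X) (h i j : ℕ) : ℕ :=
  if H : ∃ q : X × X, G.dist q.1 q.2 = h then (meet G i j H.choose.1 H.choose.2).card else 0

theorem interNum_eq {G : SimpleGraph X} (hG : IsDistanceRegular G) (i j : ℕ) (x y : X) :
    interNum G (G.dist x y) i j = (meet G i j x y).card := by
  have H : ∃ q : X × X, G.dist q.1 q.2 = G.dist x y := ⟨(x, y), rfl⟩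
  rw [interNum, dif_pos H]
  exact hG.2 i j _ _ _ _ H.choose_spec

/-- `c_i = p^i_{1,i-1}` (used for `i ≥ 1`). -/
def cNum (G : SimpleGraph X) (i : ℕ) : ℕ := interNum G i 1 (i - 1)

/-- `a_i = p^i_{1,i}`. -/
def aNum (G : SimpleGraph X) (i : ℕ) : ℕ := interNum G i 1 i

/-- `b_i = p^i_{1,i+1}`. -/
def bNum (G : SimpleGraph X) (i : ℕ) : ℕ := interNum G i 1 (i + 1)

/-- `k_i = p^0_{i,i}`, the number of vertices at distance `i` from a vertex. -/
def kNum (G : SimpleGraph X) (i : ℕ) : ℕ := interNum G 0 i i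

/-- The `i`th distance matrix `A_i`. -/
def distMatrix (G : SimpleGraph X) (i : ℕ) : Matrix X X ℝ :=
  Matrix.of fun x y => if G.dist x y = i then 1 else 0

/-- The Bose-Mesner algebra, as the span of the distance matrices `A_0, …, A_D`. -/
def boseMesner (G : SimpleGraph X) : Submodule ℝ (Matrix X X ℝ) :=
  Submodule.span ℝ (Set.range fun i : Fin (G.diam + 1) => distMatrix G i)

/-- `E_0, …, E_D` is an ordering of the primitive idempotents, with `E_0 = |X|⁻¹ J` the trivial
one: a basis of the Bose-Mesner algebra that consists of symmetric mutually orthogonal idempotents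
with sum the identity matrix. -/
structure IsIdempotentOrdering [DecidableEq X] (G : SimpleGraph X)
    (E : Fin (G.diam + 1) → Matrix X X ℝ) : Prop where
  linearIndependent : LinearIndependent ℝ E
  span_eq : Submodule.span ℝ (Set.range E) = boseMesner G
  trivial_eq : E 0 = (Fintype.card X : ℝ)⁻¹ • Matrix.of fun _ _ => (1 : ℝ)
  sum_eq : ∑ i, E i = 1
  symm : ∀ i, (E i)ᵀ = E i
  mul_eq : ∀ i j, E i * E j = if i = j then E i else 0

/-- `q h i j` is the Krein parameter `q^h_{i,j}`: here
`E_i ∘ E_j = |X|⁻¹ ∑_h q^h_{i,j} E_h` for the entrywise product `∘`. -/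
def IsKrein (G : SimpleGraph X) (E : Fin (G.diam + 1) → Matrix X X ℝ)
    (q : Fin (G.diam + 1) → Fin (G.diam + 1) → Fin (G.diam + 1) → ℝ) : Prop :=
  ∀ i j, E i ⊙ E j = (Fintype.card X : ℝ)⁻¹ • ∑ h, q h i j • E h

/-- The ordering `E_0, …, E_D` of the primitive idempotents is `Q`-polynomial: `q^h_{i,j}` vanishes
if one of `h, i, j` is greater than the sum of the other two, and does not vanish if one of them is
equal to the sum of the other two. -/
def IsQPolynomialOrdering [DecidableEq X] (G : SimpleGraph X)
    (E : Fin (G.diam + 1) → Matrix X X ℝ) : Prop :=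
  IsIdempotentOrdering G E ∧
    ∃ q : Fin (G.diam + 1) → Fin (G.diam + 1) → Fin (G.diam + 1) → ℝ, IsKrein G E q ∧
      ∀ h i j : Fin (G.diam + 1),
        (((h : ℕ) > i + j ∨ (i : ℕ) > h + j ∨ (j : ℕ) > h + i) → q h i j = 0) ∧
        (((h : ℕ) = i + j ∨ (i : ℕ) = h + j ∨ (j : ℕ) = h + i) → q h i j ≠ 0)

/-- `E` is a `Q`-polynomial primitive idempotent: `E = E_1` for some `Q`-polynomial ordering. -/
def IsQPolynomialIdempotent [DecidableEq X] (G : SimpleGraph X) (E : Matrix X X ℝ) : Prop :=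
  ∃ F : Fin (G.diam + 1) → Matrix X X ℝ, IsQPolynomialOrdering G F ∧ E = F 1

open Classical in
/-- The dual eigenvalue `θ*_i` of `E`: the common value of `|X| E_{x,y}` over the vertices `x, y`
at distance `i`. That is, `E = |X|⁻¹ ∑_i θ*_i A_i` (see `eq_sum_dualEigenvalue`). -/
def dualEigenvalue (G : SimpleGraph X) (E : Matrix X X ℝ) (i : ℕ) : ℝ :=
  if H : ∃ q : X × X, G.dist q.1 q.2 = i
  then (Fintype.card X : ℝ) * E H.choose.1 H.choose.2 else 0

theorem apply_eq_of_mem_boseMesner {Y : Type*} {G : SimpleGraph Y} {E : Matrix Y Y ℝ}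
    (hE : E ∈ boseMesner G) {x y x' y' : Y} (h : G.dist x y = G.dist x' y') : E x y = E x' y' := by
  induction hE using Submodule.span_induction with
  | mem M hM => obtain ⟨i, rfl⟩ := hM; simp [distMatrix, h]
  | zero => simp
  | add M N _ _ hM hN => simp [hM, hN]
  | smul r M _ hM => simp [hM]

theorem eq_sum_dualEigenvalue {G : SimpleGraph X} (hG : G.Connected) {E : Matrix X X ℝ}
    (hE : E ∈ boseMesner G) :
    E = (Fintype.card X : ℝ)⁻¹ •
      ∑ i ∈ Finset.range (G.diam + 1), dualEigenvalue G E i • distMatrix G i := by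
  ext x y
  have := hG.nonempty
  have hc : (Fintype.card X : ℝ) ≠ 0 := by simp
  have hd : G.dist x y ∈ Finset.range (G.diam + 1) :=
    Finset.mem_range.2 (Nat.lt_succ_of_le
      (SimpleGraph.dist_le_diam (SimpleGraph.connected_iff_ediam_ne_top.1 hG)))
  have H : ∃ q : X × X, G.dist q.1 q.2 = G.dist x y := ⟨(x, y), rfl⟩
  have e : dualEigenvalue G E (G.dist x y) = (Fintype.card X : ℝ) * E x y := by
    rw [dualEigenvalue, dif_pos H, apply_eq_of_mem_boseMesner hE H.choose_spec]
  simp only [Matrix.smul_apply, Matrix.sum_apply, distMatrix, Matrix.of_apply, smul_eq_mul,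
    mul_ite, mul_one, mul_zero, Finset.sum_ite_eq, hd, if_true, e]
  field_simp

/-- `x⁻_y`, the sum of `ẑ` over `z ∈ Γ(x) ∩ Γ_{i-1}(y)`, where `i` is the distance of `x` and `y`
(zero for `x = y`). -/
def xMinus [DecidableEq X] (G : SimpleGraph X) (x y : X) : X → ℝ :=
  ∑ z ∈ Finset.univ.filter (fun z => G.dist x z = 1 ∧ G.dist y z + 1 = G.dist x y), Pi.single z 1

/-- `x⁺_y`, the sum of `ẑ` over `z ∈ Γ(x) ∩ Γ_{i+1}(y)`, where `i` is the distance of `x`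
and `y`. -/
def xPlus [DecidableEq X] (G : SimpleGraph X) (x y : X) : X → ℝ :=
  ∑ z ∈ Finset.univ.filter (fun z => G.dist x z = 1 ∧ G.dist y z = G.dist x y + 1), Pi.single z 1

/-- The vectors `E x⁻_y`, `E x⁺_y`, `E x̂`, `E ŷ` are linearly dependent. -/
def FourDependent [DecidableEq X] (G : SimpleGraph X) (E : Matrix X X ℝ) (x y : X) : Prop :=
  ¬ LinearIndependent ℝ
    ![E *ᵥ xMinus G x y, E *ᵥ xPlus G x y, E *ᵥ Pi.single x 1, E *ᵥ Pi.single y 1]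

/-- `(x, y, z, w)` is an `i`-kite (used for `i ≥ 2`). -/
def IsKite (G : SimpleGraph X) (i : ℕ) (x y z w : X) : Prop :=
  G.dist x y = i ∧ G.dist x z = 1 ∧ G.dist y z = i - 1 ∧
    G.dist x w = 1 ∧ G.dist y w = i - 1 ∧ G.dist z w = 1

/-- The `i`th kite number `z_i`: the number of `i`-kites divided by `|X| k_i c_i`. -/
def kiteNumber (G : SimpleGraph X) (i : ℕ) : ℝ :=
  (Nat.card {t : X × X × X × X // IsKite G i t.1 t.2.1 t.2.2.1 t.2.2.2} : ℝ) /
    ((Fintype.card X : ℝ) * kNum G i * cNum G i)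

/-- The kite function `ζ_i(x, y, z) = |Γ(x) ∩ Γ_{i-1}(y) ∩ Γ(z)|`. -/
def kiteFun (G : SimpleGraph X) (i : ℕ) (x y z : X) : ℕ :=
  (Finset.univ.filter fun w => G.dist x w = 1 ∧ G.dist y w = i - 1 ∧ G.dist z w = 1).card

/-- `ζ_i(x, y, *)`, the average of `ζ_i(x, y, z)` over `z ∈ Γ(x) ∩ Γ_{i-1}(y)`. -/
def kiteAvgRight (G : SimpleGraph X) (i : ℕ) (x y : X) : ℝ :=
  (cNum G i : ℝ)⁻¹ * ∑ z ∈ meet G 1 (i - 1) x y, (kiteFun G i x y z : ℝ)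

/-- `ζ_i(*, y, z)`, the average of `ζ_i(x, y, z)` over `x ∈ Γ_i(y) ∩ Γ(z)`. -/
def kiteAvgLeft (G : SimpleGraph X) (i : ℕ) (y z : X) : ℝ :=
  (bNum G (i - 1) : ℝ)⁻¹ * ∑ x ∈ meet G i 1 y z, (kiteFun G i x y z : ℝ)

/-- The graph is reinforced: for `2 ≤ i ≤ D`, the average `ζ_i(x, y, *)` is the same for all `x, y`
at distance `i`, and the average `ζ_i(*, y, z)` is the same for all `y, z` at distance `i - 1`. -/
def IsReinforced (G : SimpleGraph X) : Prop :=
  ∀ i : ℕ, 2 ≤ i → i ≤ G.diam →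
    (∀ x y x' y' : X, G.dist x y = i → G.dist x' y' = i →
      kiteAvgRight G i x y = kiteAvgRight G i x' y') ∧
    (∀ y z y' z' : X, G.dist y z = i - 1 → G.dist y' z' = i - 1 →
      kiteAvgLeft G i y z = kiteAvgLeft G i y' z')

section Parameters

variable (G : SimpleGraph X) (E : Matrix X X ℝ)

/-- The parameter `β`, where `β + 1` is the value of `(θ*_{i-2} - θ*_{i+1}) / (θ*_{i-1} - θ*_i)`,
which is known to be the same for `2 ≤ i ≤ D - 1`; the value at `i = 2` is taken. -/
def betaParam : ℝ :=
  (dualEigenvalue G E 0 - dualEigenvalue G E 3) /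
    (dualEigenvalue G E 1 - dualEigenvalue G E 2) - 1

/-- The parameter `γ*`, the value of `θ*_{i-1} - β θ*_i + θ*_{i+1}`, which is known to be the same
for `1 ≤ i ≤ D - 1`; the value at `i = 1` is taken. -/
def gammaStar : ℝ :=
  dualEigenvalue G E 0 - betaParam G E * dualEigenvalue G E 1 + dualEigenvalue G E 2

/-- The scalar `α_i` (used for `2 ≤ i ≤ D`). -/
def alphaCoeff (i : ℕ) : ℝ :=
  let θ := dualEigenvalue G E
  (θ 1 - θ 2) * (θ 0 + θ 1 - θ (i - 1) - θ i) / ((θ 0 - θ 2) * (θ (i - 1) - θ i))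

/-- The scalar `β_i` (used for `2 ≤ i ≤ D`; not to be confused with `β`). -/
def betaCoeff (i : ℕ) : ℝ :=
  let θ := dualEigenvalue G E
  ((θ 0 - θ 1) * (θ 2 - θ i) - (θ 1 - θ 2) * (θ 1 - θ (i - 1))) /
    ((θ 0 - θ 2) * (θ (i - 1) - θ i))

/-- The scalar `r_i`. -/
def rCoeff (i : ℕ) : ℝ :=
  let θ := dualEigenvalue G E
  (cNum G i : ℝ) * ((θ 0 * θ 1 - θ (i - 1) * θ i) / (θ 0 ^ 2 - θ i ^ 2))

/-- The scalar `s_i`. -/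
def sCoeff (i : ℕ) : ℝ :=
  let θ := dualEigenvalue G E
  (cNum G i : ℝ) * ((θ 0 * θ (i - 1) - θ 1 * θ i) / (θ 0 ^ 2 - θ i ^ 2))

/-- The scalar `R_i`. -/
def bigRCoeff (i : ℕ) : ℝ :=
  let θ := dualEigenvalue G E
  (bNum G i : ℝ) * ((θ 0 * θ 1 - θ (i + 1) * θ i) / (θ 0 ^ 2 - θ i ^ 2))

/-- The scalar `S_i`. -/
def bigSCoeff (i : ℕ) : ℝ :=
  let θ := dualEigenvalue G E
  (bNum G i : ℝ) * ((θ 0 * θ (i + 1) - θ 1 * θ i) / (θ 0 ^ 2 - θ i ^ 2))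

/-- The scalar `z⁻_i`. -/
def zMinus (i : ℕ) : ℝ :=
  let θ := dualEigenvalue G E
  (rCoeff G E i * θ 1 + sCoeff G E i * θ (i - 1) - θ 0 - ((cNum G i : ℝ) - 1) * θ 2) / (θ 1 - θ 2)

/-- The scalar `z⁺_{i+1}`, as a function of `i`. -/
def zPlusSucc (i : ℕ) : ℝ :=
  let θ := dualEigenvalue G E
  (θ 0 + (aNum G 1 : ℝ) * θ 1 + ((bNum G i : ℝ) - 1 - (aNum G 1 : ℝ)) * θ 2
    - bigRCoeff G E i * θ 1 - bigSCoeff G E i * θ (i + 1)) / (θ 1 - θ 2)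

/-- The coefficient `u_i` of `Φ_i`. -/
def uCoeff (i : ℕ) : ℝ := - (alphaCoeff G E i * alphaCoeff G E (i + 1))

/-- The coefficient `v_i` of `Φ_i`. -/
def vCoeff (i : ℕ) : ℝ :=
  alphaCoeff G E i * (zPlusSucc G E i - (aNum G 1 : ℝ) * betaCoeff G E (i + 1))
    - alphaCoeff G E (i + 1) * ((aNum G 1 : ℝ) * betaCoeff G E i - zMinus G E i)

/-- The coefficient `w_i` of `Φ_i`. -/
def wCoeff (i : ℕ) : ℝ :=
  let θ := dualEigenvalue G E
  ((aNum G 1 : ℝ) * betaCoeff G E i - zMinus G E i)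
      * (zPlusSucc G E i - (aNum G 1 : ℝ) * betaCoeff G E (i + 1))
    - (cNum G i : ℝ) * (bNum G i : ℝ)
      * (gammaStar G E / (θ 1 - θ 2) * ((θ i - θ 1) / (θ i + θ 0))) ^ 2

/-- The polynomial `Φ_i(λ) = u_i λ² + v_i λ + w_i` (used for `2 ≤ i ≤ D - 1`). -/
def Phi (i : ℕ) : Polynomial ℝ :=
  Polynomial.C (uCoeff G E i) * Polynomial.X ^ 2 + Polynomial.C (vCoeff G E i) * Polynomial.X
    + Polynomial.C (wCoeff G E i)

end Parameters

end DistanceRegular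

end

namespace DistanceRegular

variable {X : Type*} {G : SimpleGraph X}

/-! Write `θ j` for `dualEigenvalue G E j`. The value `Φ_i(z_2)` is a Gram determinant in disguise.
Since `E` is a symmetric idempotent whose entry at a pair at distance `j` is `θ j / |X|`, inner
products of images under `E` are sums of dual eigenvalues. For `∂(x,y) = i`, the Gram matrix of the
four vectors is therefore fixed by the intersection numbers, except for the squared norms of `E
x⁻_y` and `E x⁺_y`. These involve the number of adjacent pairs inside `Γ(x) ∩ Γ_{i∓1}(y)`, and
reinforcement makes that number depend only on `z_i`, respectively on `z_{i+1}`.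

The scalars `r, s, R, S` give the orthogonal projections of `E x⁻_y` and `E x⁺_y` on the span of `E
x̂, E ŷ`, two vectors that are independent because `θ i ≠ ±θ 0`. After subtracting the projections,
the remaining 2×2 determinant is a positive multiple of `(z_i - z⁻_i)(z⁺_{i+1} - z_{i+1}) - c_i b_i
K²`, where the inner product `K` is evaluated by `cross_identity`. Cauchy–Schwarz gives the
inequality, and vanishing means dependence. The determinant does not depend on the pair `x, y`, so
"some pair" and "all pairs" agree.

It remains to express `z_i` and `z_{i+1}` through `z_2`: `z_j = α_j z_2 + a_1 β_j`
(`kiteNumber_formula`). For this, the matrix of sums of `θ(∂(y,p)) θ(∂(y,q))` over triangles `r, p,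
q` lies in the Bose–Mesner algebra by reinforcement, and it is orthogonal to `E_s` for `s ≥ 3`
because `q^1_{1,s} = 0`. Hence it lies in the span of `J, E, E ∘ E` (`exists_quad_kites`). This is a
recurrence for the kite numbers up to an unknown quadratic in `θ j`, and a summation argument
removes the unknown. -/

theorem exists_dist_step (hG : G.Connected) {x y : X} {m : ℕ} (h : G.dist x y = m + 1) :
    ∃ z, G.dist x z = 1 ∧ G.dist z y = m := by
  obtain ⟨p, hp⟩ := hG.exists_walk_length_eq_dist x y
  cases p with
  | nil => simp at h
  | @cons _ z _ hxz p =>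
    refine ⟨z, SimpleGraph.dist_eq_one_iff_adj.2 hxz, ?_⟩
    have h1 := SimpleGraph.dist_le p
    have h2 : G.dist x y ≤ G.dist x z + G.dist z y := hG.dist_triangle
    rw [SimpleGraph.dist_eq_one_iff_adj.2 hxz] at h2
    simp only [SimpleGraph.Walk.length_cons] at hp
    omega

theorem exists_dist_add (hG : G.Connected) {y : X} {a b : ℕ} : ∀ {x : X}, G.dist x y = a + b →
    ∃ z, G.dist x z = a ∧ G.dist z y = b := by
  induction a with
  | zero => intro x h; exact ⟨x, by simp, by simpa using h⟩
  | succ a ih =>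
    intro x h
    obtain ⟨u, hu, huy⟩ := exists_dist_step hG (show G.dist x y = (a + b) + 1 by omega)
    obtain ⟨z, hz, hzy⟩ := ih huy
    refine ⟨z, ?_, hzy⟩
    have h1 : G.dist x z ≤ G.dist x u + G.dist u z := hG.dist_triangle
    have h2 : G.dist x y ≤ G.dist x z + G.dist z y := hG.dist_triangle
    omega

theorem exists_dist_eq [Finite X] (hG : G.Connected) {i : ℕ} (hi : i ≤ G.diam) :
    ∃ x y, G.dist x y = i := by
  have := hG.nonempty
  obtain ⟨u, v, huv⟩ := SimpleGraph.exists_dist_eq_diam (G := G)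
  obtain ⟨z, hz, -⟩ := exists_dist_add hG (show G.dist u v = i + (G.diam - i) by omega)
  exact ⟨u, z, hz⟩

theorem dist_le_diam [Finite X] (hG : G.Connected) (x y : X) : G.dist x y ≤ G.diam := by
  have := hG.nonempty
  exact SimpleGraph.dist_le_diam (SimpleGraph.connected_iff_ediam_ne_top.1 hG)

/-- Distances to a fixed vertex change by at most one along an edge. -/
theorem dist_near (hG : G.Connected) {y w : X} (h : G.dist y w = 1) (r : X) :
    G.dist r w ≤ G.dist r y + 1 ∧ G.dist r y ≤ G.dist r w + 1 := by
  have h1 : G.dist r w ≤ G.dist r y + G.dist y w := hG.dist_triangle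
  have h2 : G.dist r y ≤ G.dist r w + G.dist w y := hG.dist_triangle
  rw [SimpleGraph.dist_comm (u := w)] at h2
  omega

/-! ### Intersection numbers and sums over neighbours. -/

variable [Fintype X]

theorem mem_meet {i j : ℕ} {x y z : X} : z ∈ meet G i j x y ↔ G.dist x z = i ∧ G.dist y z = j := by
  simp [meet]

theorem interNum_eq' (hG : IsDistanceRegular G) {h : ℕ} (i j : ℕ) {x y : X} (hxy : G.dist x y = h) :
    interNum G h i j = (meet G i j x y).card := hxy ▸ interNum_eq hG i j x y

theorem cNum_pos (hG : IsDistanceRegular G) {i : ℕ} (hi : 1 ≤ i) (hiD : i ≤ G.diam) :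
    0 < cNum G i := by
  obtain ⟨x, y, hxy⟩ := exists_dist_eq hG.1 hiD
  obtain ⟨z, hz, hzy⟩ := exists_dist_add hG.1 (show G.dist x y = 1 + (i - 1) by omega)
  rw [cNum, interNum_eq' hG _ _ hxy]
  exact Finset.card_pos.2 ⟨z, mem_meet.2 ⟨hz, by rwa [SimpleGraph.dist_comm]⟩⟩

theorem bNum_pos (hG : IsDistanceRegular G) {i : ℕ} (hiD : i + 1 ≤ G.diam) :
    0 < bNum G i := by
  obtain ⟨z, y, hzy⟩ := exists_dist_eq hG.1 hiD
  obtain ⟨x, hzx, hxy⟩ := exists_dist_add hG.1 (show G.dist z y = 1 + i by omega)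
  rw [bNum, interNum_eq' hG _ _ hxy]
  exact Finset.card_pos.2 ⟨z, mem_meet.2 ⟨by rwa [SimpleGraph.dist_comm],
    by rwa [SimpleGraph.dist_comm]⟩⟩

theorem bNum_diam (hG : IsDistanceRegular G) : bNum G G.diam = 0 := by
  obtain ⟨x, y, hxy⟩ := exists_dist_eq hG.1 le_rfl
  rw [bNum, interNum_eq' hG _ _ hxy, Finset.card_eq_zero, Finset.eq_empty_iff_forall_notMem]
  intro z hz
  have := dist_le_diam hG.1 y z
  have := (mem_meet.1 hz).2
  omega

theorem cNum_zero (hG : IsDistanceRegular G) : cNum G 0 = 0 := by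
  obtain ⟨x, y, hxy⟩ := exists_dist_eq hG.1 (Nat.zero_le _)
  rw [cNum, interNum_eq' hG _ _ hxy, Finset.card_eq_zero, Finset.eq_empty_iff_forall_notMem]
  intro z hz
  have := mem_meet.1 hz
  rw [hG.1.dist_eq_zero_iff] at hxy
  subst hxy
  omega

/-- Truncated subtraction makes `c_0` and `a_0` the same number `p^0_{1,0}`. -/
theorem aNum_zero (hG : IsDistanceRegular G) : aNum G 0 = 0 := cNum_zero hG

/-- The neighbours `w` of `y` split according to their distance from `r`. -/
theorem sum_neighbors_split (hG : IsDistanceRegular G) (φ : X → ℝ) {y r : X} {j : ℕ}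
    (h : G.dist y r = j) :
    ∑ w with G.dist y w = 1, φ w =
      ∑ w ∈ meet G 1 (j - 1) y r, φ w + ∑ w ∈ meet G 1 j y r, φ w
        + ∑ w ∈ meet G 1 (j + 1) y r, φ w := by
  have hb : ∀ w, G.dist y w = 1 → G.dist r w ≤ j + 1 ∧ j ≤ G.dist r w + 1 := by
    intro w hw
    have := dist_near hG.1 hw r
    rwa [SimpleGraph.dist_comm (u := r) (v := y), h] at this
  have h0 : j = 0 → ∀ w, G.dist y w = 1 → G.dist r w = 1 := by
    rintro rfl w hw
    rwa [← hG.1.dist_eq_zero_iff.1 h]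
  have key : ∀ m : ℕ, ∑ w ∈ meet G 1 m y r, φ w =
      ∑ w with G.dist y w = 1, if G.dist r w = m then φ w else 0 := by
    intro m
    rw [← Finset.sum_filter, Finset.filter_filter, meet]
  rw [key, key, key, ← Finset.sum_add_distrib, ← Finset.sum_add_distrib]
  refine Finset.sum_congr rfl fun w hw => ?_
  replace hw := (Finset.mem_filter.1 hw).2
  have h1 := hb w hw
  have h2 := fun e => h0 e w hw
  have : (j ≠ 0 ∧ G.dist r w = j - 1) ∨ G.dist r w = j ∨ G.dist r w = j + 1 := by omega
  rcases this with h | h | h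
  · rw [if_pos h.2, if_neg (by omega), if_neg (by omega)]; ring
  · rw [if_pos h, if_neg (by omega), if_neg (by omega)]; ring
  · rw [if_pos h, if_neg (by omega), if_neg (by omega)]; ring

theorem sum_neighbors (hG : IsDistanceRegular G) (φ : ℕ → ℝ) {y r : X} {j : ℕ}
    (h : G.dist y r = j) :
    ∑ w with G.dist y w = 1, φ (G.dist r w) =
      cNum G j * φ (j - 1) + aNum G j * φ j + bNum G j * φ (j + 1) := by
  have key : ∀ m : ℕ, ∑ w ∈ meet G 1 m y r, φ (G.dist r w) = interNum G j 1 m * φ m := by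
    intro m
    rw [interNum_eq' hG _ _ h, ← nsmul_eq_mul, ← Finset.sum_const]
    exact Finset.sum_congr rfl fun w hw => by rw [(mem_meet.1 hw).2]
  rw [sum_neighbors_split hG _ h, key, key, key]
  rfl

theorem fin_one_val {X : Type*} {G : SimpleGraph X} (hD : 3 ≤ G.diam) :
    ((1 : Fin (G.diam + 1)) : ℕ) = 1 := by
  rw [Fin.val_one', Nat.mod_eq_of_lt]
  omega

/-! ### Krein parameters, dual eigenvalues and their three-term recurrence. -/

section QPolynomial

variable {X : Type*} [Fintype X] {G : SimpleGraph X} {E : Matrix X X ℝ}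

theorem dualEigenvalue_dist (hE : E ∈ boseMesner G) (x y : X) :
    dualEigenvalue G E (G.dist x y) = Fintype.card X * E x y := by
  have H : ∃ q : X × X, G.dist q.1 q.2 = G.dist x y := ⟨(x, y), rfl⟩
  rw [dualEigenvalue, dif_pos H, apply_eq_of_mem_boseMesner hE H.choose_spec]

theorem apply_eq_dualEigenvalue (hE : E ∈ boseMesner G) (x y : X) :
    E x y = (Fintype.card X : ℝ)⁻¹ * dualEigenvalue G E (G.dist x y) := by
  have : Nonempty X := ⟨x⟩
  have hc : (Fintype.card X : ℝ) ≠ 0 := by simp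
  rw [dualEigenvalue_dist hE]
  field_simp

theorem mem_boseMesner_of_dist (hG : G.Connected) {M : Matrix X X ℝ} (f : ℕ → ℝ)
    (h : ∀ x y, M x y = f (G.dist x y)) : M ∈ boseMesner G := by
  have : M = ∑ i : Fin (G.diam + 1), f i • distMatrix G i := by
    ext x y
    have hd : G.dist x y < G.diam + 1 := Nat.lt_succ_of_le (dist_le_diam hG x y)
    rw [h, Matrix.sum_apply, Finset.sum_eq_single ⟨G.dist x y, hd⟩]
    · simp [distMatrix]
    · intro b _ hb
      have : G.dist x y ≠ b := fun e => hb (Fin.ext e.symm)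
      simp [distMatrix, this]
    · simp
  rw [this]
  exact Submodule.sum_mem _ fun i _ => Submodule.smul_mem _ _ (Submodule.subset_span ⟨i, rfl⟩)

theorem distMatrix_mem_boseMesner (hG : G.Connected) (i : ℕ) : distMatrix G i ∈ boseMesner G :=
  mem_boseMesner_of_dist hG (fun j => if j = i then 1 else 0) fun x y => by simp [distMatrix]

variable [DecidableEq X] {F : Fin (G.diam + 1) → Matrix X X ℝ}

theorem IsIdempotentOrdering.mem (hF : IsIdempotentOrdering G F) (i : Fin (G.diam + 1)) :
    F i ∈ boseMesner G := by
  rw [← hF.span_eq]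
  exact Submodule.subset_span ⟨i, rfl⟩

theorem IsIdempotentOrdering.apply_comm (hF : IsIdempotentOrdering G F) (i : Fin (G.diam + 1))
    (x y : X) : F i x y = F i y x := by
  conv_lhs => rw [← hF.symm i]
  rfl

theorem IsIdempotentOrdering.exists_coeff (hF : IsIdempotentOrdering G F) {M : Matrix X X ℝ}
    (hM : M ∈ boseMesner G) : ∃ t : Fin (G.diam + 1) → ℝ, ∑ i, t i • F i = M := by
  rw [← hF.span_eq] at hM
  exact (Submodule.mem_span_range_iff_exists_fun ℝ).1 hM

theorem IsIdempotentOrdering.sum_smul_mul (hF : IsIdempotentOrdering G F)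
    (t : Fin (G.diam + 1) → ℝ) (s : Fin (G.diam + 1)) : (∑ i, t i • F i) * F s = t s • F s := by
  rw [Finset.sum_mul, Finset.sum_eq_single s]
  · rw [smul_mul_assoc, hF.mul_eq, if_pos rfl]
  · intro b _ hb
    rw [smul_mul_assoc, hF.mul_eq, if_neg hb, smul_zero]
  · simp

/-- The squared Frobenius norm of the product is `d ⬝ᵥ (F i ⊙ F j) d` for the column `d` of `F h` at
`p`. In the Krein expansion of `F i ⊙ F j` only `F h` fails to kill `d`, and its coefficient is a
multiple of `q h i j`. -/
theorem IsIdempotentOrdering.mul_diagonal_mul_eq_zero (hF : IsIdempotentOrdering G F)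
    {q : Fin (G.diam + 1) → Fin (G.diam + 1) → Fin (G.diam + 1) → ℝ} (hq : IsKrein G F q)
    {h i j : Fin (G.diam + 1)} (h0 : q h i j = 0) (p : X) :
    F i * Matrix.diagonal (fun y => F h y p) * F j = 0 := by
  set d : X → ℝ := fun y => F h y p with hd
  have hFd : ∀ l, F l *ᵥ d = if l = h then d else 0 := by
    intro l
    have : F l *ᵥ d = fun y => (F l * F h) y p := by
      ext y; rfl
    rw [this, hF.mul_eq]
    split_ifs with hl
    · rw [hl]
    · rfl
  rw [← Matrix.trace_conjTranspose_mul_self_eq_zero_iff]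
  simp only [Matrix.conjTranspose_eq_transpose_of_trivial, Matrix.transpose_mul,
    Matrix.diagonal_transpose, hF.symm]
  have e1 : F j * (Matrix.diagonal d * F i) * (F i * Matrix.diagonal d * F j)
      = F j * (Matrix.diagonal d * (F i * F i) * Matrix.diagonal d * F j) := by
    simp only [Matrix.mul_assoc]
  rw [e1, Matrix.trace_mul_comm, Matrix.mul_assoc, hF.mul_eq, hF.mul_eq, if_pos rfl, if_pos rfl]
  have e2 : (Matrix.diagonal d * F i * Matrix.diagonal d * F j).trace
      = d ⬝ᵥ ((F i ⊙ F j) *ᵥ d) := by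
    simp only [Matrix.trace, Matrix.diag, dotProduct, Matrix.mulVec, Matrix.hadamard_apply]
    refine Finset.sum_congr rfl fun y _ => ?_
    rw [Matrix.mul_apply, Finset.mul_sum]
    refine Finset.sum_congr rfl fun z _ => ?_
    rw [Matrix.mul_diagonal, Matrix.diagonal_mul, hF.apply_comm j z y]
    ring
  rw [e2, hq, Matrix.smul_mulVec, Matrix.sum_mulVec, Finset.sum_eq_zero]
  · simp
  · intro l _
    rw [Matrix.smul_mulVec, hFd]
    split_ifs with hl
    · rw [hl, h0, zero_smul]
    · rw [smul_zero]

theorem IsIdempotentOrdering.sum_mul_mul_eq_zero (hF : IsIdempotentOrdering G F)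
    {q : Fin (G.diam + 1) → Fin (G.diam + 1) → Fin (G.diam + 1) → ℝ} (hq : IsKrein G F q)
    {h i j : Fin (G.diam + 1)} (h0 : q h i j = 0) (p r s : X) :
    ∑ y, F h y p * F i y r * F j y s = 0 := by
  have := congrFun (congrFun (hF.mul_diagonal_mul_eq_zero hq h0 p) r) s
  rw [Matrix.mul_apply] at this
  rw [← Matrix.zero_apply (α := ℝ) r s, ← this]
  refine Finset.sum_congr rfl fun y _ => ?_
  rw [Matrix.mul_diagonal, hF.apply_comm i r y]
  ring

/-- `E_1` generates the algebra under the entrywise product: `E_1 ∘ E_m` involves `E_{m+1}` with a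
nonzero coefficient and otherwise only lower terms. So two entries that agree in `E_1` agree in
every `E_m`, hence in every distance matrix. -/
theorem IsQPolynomialOrdering.dist_eq_of_apply_eq (hD : 3 ≤ G.diam) (hG : G.Connected)
    (hF : IsQPolynomialOrdering G F) {x y x' y' : X} (h : F 1 x y = F 1 x' y') :
    G.dist x y = G.dist x' y' := by
  have : Nonempty X := ⟨x⟩
  have hc : (Fintype.card X : ℝ) ≠ 0 := by simp
  obtain ⟨hI, q, hq, hqq⟩ := hF
  have h1 := fin_one_val hD
  have key : ∀ m : ℕ, ∀ hm : m < G.diam + 1, F ⟨m, hm⟩ x y = F ⟨m, hm⟩ x' y' := by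
    intro m
    induction m using Nat.strong_induction_on with
    | _ m ih =>
      intro hm
      rcases m with - | m
      · have : (⟨0, hm⟩ : Fin (G.diam + 1)) = 0 := rfl
        rw [this, hI.trivial_eq]
        simp
      · have hm' : m < G.diam + 1 := by omega
        have e := hq 1 ⟨m, hm'⟩
        have ex := congrFun (congrFun e x) y
        have ex' := congrFun (congrFun e x') y'
        have hne : q ⟨m + 1, hm⟩ 1 ⟨m, hm'⟩ ≠ 0 := (hqq _ _ _).2 (by
          left
          change m + 1 = ((1 : Fin (G.diam + 1)) : ℕ) + m
          omega)
        simp only [Matrix.hadamard_apply, Matrix.smul_apply, Matrix.sum_apply, smul_eq_mul]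
          at ex ex'
        rw [h, ih m (by omega) hm', ex'] at ex
        have ex2 := mul_left_cancel₀ (inv_ne_zero hc) ex
        rw [← Finset.add_sum_erase _ _ (Finset.mem_univ (⟨m + 1, hm⟩ : Fin (G.diam + 1))),
          ← Finset.add_sum_erase _ _ (Finset.mem_univ (⟨m + 1, hm⟩ : Fin (G.diam + 1)))] at ex2
        have e3 : ∑ l ∈ Finset.univ.erase (⟨m + 1, hm⟩ : Fin (G.diam + 1)),
            q l 1 ⟨m, hm'⟩ * F l x' y' = ∑ l ∈ Finset.univ.erase (⟨m + 1, hm⟩ : Fin (G.diam + 1)),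
            q l 1 ⟨m, hm'⟩ * F l x y := by
          refine Finset.sum_congr rfl fun l hl => ?_
          have hl' : (l : ℕ) ≠ m + 1 := fun e => (Finset.mem_erase.1 hl).1 (Fin.ext e)
          rcases lt_or_gt_of_ne hl' with hlt | hgt
          · rw [← ih l hlt l.2]
          · rw [(hqq l 1 ⟨m, hm'⟩).1 (by left; simp only [h1]; omega)]
            simp
        rw [e3] at ex2
        exact (mul_left_cancel₀ hne (add_right_cancel ex2)).symm
  by_contra hne
  obtain ⟨t, ht⟩ := hI.exists_coeff (distMatrix_mem_boseMesner hG (G.dist x y))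
  have h2 : distMatrix G (G.dist x y) x y = distMatrix G (G.dist x y) x' y' := by
    rw [← ht, Matrix.sum_apply, Matrix.sum_apply]
    refine Finset.sum_congr rfl fun i _ => ?_
    rw [Matrix.smul_apply, Matrix.smul_apply, key i i.2]
  simp [distMatrix, Ne.symm hne] at h2

theorem IsQPolynomialOrdering.dualEigenvalue_injOn (hD : 3 ≤ G.diam) (hG : G.Connected)
    (hF : IsQPolynomialOrdering G F) {i j : ℕ} (hi : i ≤ G.diam) (hj : j ≤ G.diam)
    (h : dualEigenvalue G (F 1) i = dualEigenvalue G (F 1) j) : i = j := by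
  obtain ⟨x, y, rfl⟩ := exists_dist_eq hG hi
  obtain ⟨x', y', rfl⟩ := exists_dist_eq hG hj
  apply hF.dist_eq_of_apply_eq hD hG
  rw [apply_eq_dualEigenvalue (hF.1.mem 1), apply_eq_dualEigenvalue (hF.1.mem 1), h]

theorem IsIdempotentOrdering.sum_apply_mul_apply (hF : IsIdempotentOrdering G F)
    (s : Fin (G.diam + 1)) (x y : X) : ∑ w, F s x w * F s w y = F s x y := by
  rw [← Matrix.mul_apply, hF.mul_eq, if_pos rfl]

theorem IsIdempotentOrdering.apply_eq_zero_of_apply_self (hF : IsIdempotentOrdering G F)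
    {s : Fin (G.diam + 1)} {x : X} (h : F s x x = 0) (w : X) : F s x w = 0 := by
  have h2 := hF.sum_apply_mul_apply s x x
  rw [h, Finset.sum_eq_zero_iff_of_nonneg] at h2
  · have := h2 w (Finset.mem_univ w)
    rw [hF.apply_comm s w x] at this
    exact mul_self_eq_zero.1 this
  · intro i _
    rw [hF.apply_comm s i x]
    exact mul_self_nonneg _

theorem IsQPolynomialOrdering.dualEigenvalue_zero_pos (hD : 3 ≤ G.diam) (hG : G.Connected)
    (hF : IsQPolynomialOrdering G F) : 0 < dualEigenvalue G (F 1) 0 := by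
  obtain ⟨x, y, hxy⟩ := exists_dist_eq hG (show 1 ≤ G.diam by omega)
  have : Nonempty X := ⟨x⟩
  have hc : (0 : ℝ) < Fintype.card X := by exact_mod_cast Fintype.card_pos
  have h0 : dualEigenvalue G (F 1) 0 = Fintype.card X * F 1 x x := by
    rw [← dualEigenvalue_dist (hF.1.mem 1), SimpleGraph.dist_self]
  rw [h0]
  refine mul_pos hc (lt_of_le_of_ne ?_ ?_)
  · rw [← hF.1.sum_apply_mul_apply]
    refine Finset.sum_nonneg fun w _ => ?_
    rw [hF.1.apply_comm 1 w x]
    exact mul_self_nonneg _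
  · intro h
    have h1 := hF.1.apply_eq_zero_of_apply_self h.symm y
    have := hF.dist_eq_of_apply_eq hD hG (h.symm.trans h1.symm)
    simp [hxy] at this

theorem IsQPolynomialOrdering.sum_dualEigenvalue (hD : 3 ≤ G.diam)
    (hF : IsQPolynomialOrdering G F) (r : X) : ∑ y, dualEigenvalue G (F 1) (G.dist r y) = 0 := by
  have : Nonempty X := ⟨r⟩
  have hc : (Fintype.card X : ℝ) ≠ 0 := by simp
  have h := congrFun (congrFun (hF.1.mul_eq 1 0) r) r
  rw [if_neg, Matrix.mul_apply, hF.1.trivial_eq] at h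
  · simp only [Matrix.smul_apply, Matrix.of_apply, smul_eq_mul, mul_one, Matrix.zero_apply,
      ← Finset.sum_mul] at h
    have h2 := (mul_eq_zero.1 h).resolve_right (inv_ne_zero hc)
    simp only [dualEigenvalue_dist (hF.1.mem 1), ← Finset.mul_sum, h2, mul_zero]
  · intro e
    have := congrArg Fin.val e
    rw [fin_one_val hD] at this
    simp at this

/-- If `θ i = -θ 0`, then `E(x̂ + ŷ)` has norm zero for `∂(x,y) = i`, so rows `x` and `y` of `E` are
opposite. Neighbours `u, v` of `x` at distances `i + 1` and `i - 1` from `y` have equal entries in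
row `x`, hence in row `y`, against the distinctness of the dual eigenvalues. The bound `i < D`
supplies `u`. -/
theorem IsQPolynomialOrdering.dualEigenvalue_ne_neg (hD : 3 ≤ G.diam) (hG : IsDistanceRegular G)
    (hF : IsQPolynomialOrdering G F) {i : ℕ} (hi : 1 ≤ i) (hiD : i + 1 ≤ G.diam) :
    dualEigenvalue G (F 1) i + dualEigenvalue G (F 1) 0 ≠ 0 := by
  intro h
  obtain ⟨u, y, huy⟩ := exists_dist_eq hG.1 hiD
  obtain ⟨x, hux, hxy⟩ := exists_dist_add hG.1 (show G.dist u y = 1 + i by omega)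
  obtain ⟨v, hxv, hvy⟩ := exists_dist_add hG.1 (show G.dist x y = 1 + (i - 1) by omega)
  have : Nonempty X := ⟨x⟩
  have hc : (Fintype.card X : ℝ) ≠ 0 := by simp
  have hE := hF.1.mem 1
  have h0 : ∀ z, F 1 z z = (Fintype.card X : ℝ)⁻¹ * dualEigenvalue G (F 1) 0 := fun z => by
    rw [apply_eq_dualEigenvalue hE, SimpleGraph.dist_self]
  have hsq : ∑ w, (F 1 x w + F 1 y w) ^ 2 = 0 := by
    have : ∀ w, (F 1 x w + F 1 y w) ^ 2 =
        F 1 x w * F 1 w x + F 1 x w * F 1 w y + F 1 x w * F 1 w y + F 1 y w * F 1 w y := by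
      intro w
      rw [hF.1.apply_comm 1 w x, hF.1.apply_comm 1 w y]
      ring
    simp only [this, Finset.sum_add_distrib, hF.1.sum_apply_mul_apply]
    rw [h0, h0, apply_eq_dualEigenvalue hE x y, hxy]
    linear_combination 2 * (Fintype.card X : ℝ)⁻¹ * h
  rw [Finset.sum_eq_zero_iff_of_nonneg (fun _ _ => sq_nonneg _)] at hsq
  have hw : ∀ w, F 1 x w + F 1 y w = 0 := fun w =>
    pow_eq_zero_iff (two_ne_zero) |>.1 (hsq w (Finset.mem_univ w))
  have hxuv : F 1 x u = F 1 x v := by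
    apply apply_eq_of_mem_boseMesner hE
    rw [hxv, SimpleGraph.dist_comm, hux]
  have := hF.dist_eq_of_apply_eq hD hG.1 (show F 1 y u = F 1 y v by linarith [hw u, hw v])
  rw [SimpleGraph.dist_comm, huy, SimpleGraph.dist_comm, hvy] at this
  omega

/-- By bilinearity `M = E_i`, `N = E_j` suffice, and `E_i D E_j = 0` if `|i - j| > 1`. For `j = i +
1` and `P = E_0 + ⋯ + E_i`, one has `E_i D E_j = P D (1 - P)`, and antisymmetrising leaves the
commutator `P D - D P`. It matters that `R` does not depend on `p`. -/
theorem IsQPolynomialOrdering.exists_commutator (hD : 3 ≤ G.diam)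
    (hF : IsQPolynomialOrdering G F) {M N : Matrix X X ℝ} (hM : M ∈ boseMesner G)
    (hN : N ∈ boseMesner G) : ∃ R ∈ boseMesner G, ∀ p : X,
      M * Matrix.diagonal (fun y => F 1 y p) * N - N * Matrix.diagonal (fun y => F 1 y p) * M =
        Matrix.diagonal (fun y => F 1 y p) * R - R * Matrix.diagonal (fun y => F 1 y p) := by
  obtain ⟨hI, q, hq, hqq⟩ := hF
  have h1 := fin_one_val hD
  have hfar : ∀ i j : Fin (G.diam + 1), ((i : ℕ) + 1 < j ∨ (j : ℕ) + 1 < i) → ∀ p,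
      F i * Matrix.diagonal (fun y => F 1 y p) * F j = 0 := by
    intro i j hij p
    refine hI.mul_diagonal_mul_eq_zero hq ((hqq 1 i j).1 ?_) p
    rw [h1]
    omega
  have hle : ∀ i j : Fin (G.diam + 1), (i : ℕ) ≤ j → ∃ R ∈ boseMesner G, ∀ p : X,
      F i * Matrix.diagonal (fun y => F 1 y p) * F j -
        F j * Matrix.diagonal (fun y => F 1 y p) * F i =
        Matrix.diagonal (fun y => F 1 y p) * R - R * Matrix.diagonal (fun y => F 1 y p) := by
    intro i j hij
    rcases lt_trichotomy (j : ℕ) (i + 1) with hlt | heq | hgt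
    · obtain rfl : i = j := Fin.ext (by omega)
      exact ⟨0, zero_mem _, fun p => by simp⟩
    · refine ⟨-∑ s with s ≤ i, F s, neg_mem (Submodule.sum_mem _ fun s _ => hI.mem s), fun p => ?_⟩
      set D := Matrix.diagonal (fun y => F 1 y p) with hDdef
      set P := ∑ s with s ≤ i, F s with hP
      set Q := ∑ s with ¬ s ≤ i, F s with hQ
      have hPQ : P + Q = 1 := by
        rw [hP, hQ, Finset.sum_filter_add_sum_filter_not, hI.sum_eq]
      have hPDQ : P * D * Q = F i * D * F j := by
        rw [hP, hQ, Finset.sum_mul, Finset.sum_mul, Finset.sum_eq_single i]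
        · rw [Finset.mul_sum, Finset.sum_eq_single j]
          · intro t ht htj
            simp only [Finset.mem_filter, Finset.mem_univ, true_and, not_le, Fin.lt_def] at ht
            exact hfar i t (by have : (t : ℕ) ≠ j := fun e => htj (Fin.ext e); omega) p
          · intro hj
            exact absurd (Finset.mem_filter.2 ⟨Finset.mem_univ _, by rw [not_le, Fin.lt_def]; omega⟩) hj
        · intro s hs hsi
          simp only [Finset.mem_filter, Finset.mem_univ, true_and, Fin.le_def] at hs
          rw [Finset.mul_sum, Finset.sum_eq_zero]
          intro t ht
          simp only [Finset.mem_filter, Finset.mem_univ, true_and, not_le, Fin.lt_def] at ht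
          exact hfar s t (by have : (s : ℕ) ≠ i := fun e => hsi (Fin.ext e); omega) p
        · intro hi
          exact absurd (by simp) hi
      have hQDP : Q * D * P = F j * D * F i := by
        have hsymm : ∀ S : Finset (Fin (G.diam + 1)), (∑ s ∈ S, F s)ᵀ = ∑ s ∈ S, F s := by
          intro S
          rw [Matrix.transpose_sum]
          exact Finset.sum_congr rfl fun s _ => hI.symm s
        have := congrArg Matrix.transpose hPDQ
        simpa only [Matrix.transpose_mul, hP, hQ, hsymm, hI.symm, hDdef,
          Matrix.diagonal_transpose, Matrix.mul_assoc] using this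
      rw [← hPDQ, ← hQDP]
      have : Q = 1 - P := by rw [← hPQ]; abel
      rw [this]
      noncomm_ring
    · refine ⟨0, zero_mem _, fun p => ?_⟩
      rw [hfar i j (by omega), hfar j i (by omega)]
      simp
  rw [← hI.span_eq] at hM hN
  induction hM, hN using Submodule.span_induction₂ with
  | mem_mem M N hM hN =>
    obtain ⟨i, rfl⟩ := hM
    obtain ⟨j, rfl⟩ := hN
    rcases le_total (i : ℕ) j with h | h
    · exact hle i j h
    · obtain ⟨R, hR, hRe⟩ := hle j i h
      refine ⟨-R, neg_mem hR, fun p => ?_⟩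
      rw [← neg_sub, hRe p]
      noncomm_ring
  | zero_left => exact ⟨0, zero_mem _, fun p => by simp⟩
  | zero_right => exact ⟨0, zero_mem _, fun p => by simp⟩
  | add_left M M' N _ _ _ h h' =>
    obtain ⟨R, hR, hRe⟩ := h
    obtain ⟨R', hR', hRe'⟩ := h'
    refine ⟨R + R', add_mem hR hR', fun p => ?_⟩
    simp only [add_mul, mul_add, add_sub_add_comm, hRe p, hRe' p]
  | add_right M N N' _ _ _ h h' =>
    obtain ⟨R, hR, hRe⟩ := h
    obtain ⟨R', hR', hRe'⟩ := h'
    refine ⟨R + R', add_mem hR hR', fun p => ?_⟩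
    simp only [add_mul, mul_add, add_sub_add_comm, hRe p, hRe' p]
  | smul_left c M N _ _ h =>
    obtain ⟨R, hR, hRe⟩ := h
    refine ⟨c • R, Submodule.smul_mem _ _ hR, fun p => ?_⟩
    simp only [smul_mul_assoc, mul_smul_comm, ← smul_sub, hRe p]
  | smul_right c M N _ _ h =>
    obtain ⟨R, hR, hRe⟩ := h
    refine ⟨c • R, Submodule.smul_mem _ _ hR, fun p => ?_⟩
    simp only [smul_mul_assoc, mul_smul_comm, ← smul_sub, hRe p]

/-- The three-term recurrence of the dual eigenvalues, in differenced form. -/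
theorem IsQPolynomialOrdering.recurrence (hD : 3 ≤ G.diam) (hG : IsDistanceRegular G)
    (hF : IsQPolynomialOrdering G F) {j : ℕ} (hj : j + 3 ≤ G.diam) :
    (dualEigenvalue G (F 1) j - dualEigenvalue G (F 1) (j + 3)) *
        (dualEigenvalue G (F 1) 1 - dualEigenvalue G (F 1) 2) =
      (dualEigenvalue G (F 1) 0 - dualEigenvalue G (F 1) 3) *
        (dualEigenvalue G (F 1) (j + 1) - dualEigenvalue G (F 1) (j + 2)) := by
  set θ := dualEigenvalue G (F 1) with hθ
  have hE := hF.1.mem 1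
  -- The relation for `A_1, A_2` is read at an entry `(y, z)` with `p, y, z` on a geodesic and
  -- `∂(y,z) = 3`. All intermediate vertices are then forced to distance `k + 1` or `k + 2` from
  -- `p`, and the two coefficients `p^3_{1,2}` and `R_{y,z}` are the same for every `k = ∂(p,y)`.
  obtain ⟨R, hR, hRe⟩ := hF.exists_commutator hD (distMatrix_mem_boseMesner hG.1 1)
    (distMatrix_mem_boseMesner hG.1 2)
  have hinst : ∃ m ρ : ℝ, m ≠ 0 ∧ ∀ k, k + 3 ≤ G.diam →
      m * (θ (k + 1) - θ (k + 2)) = ρ * (θ k - θ (k + 3)) := by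
    obtain ⟨a, b, hab⟩ := exists_dist_eq hG.1 hD
    refine ⟨(meet G 1 2 a b).card, R a b, ?_, ?_⟩
    · obtain ⟨z, hz, hzy⟩ := exists_dist_add hG.1 (show G.dist a b = 1 + 2 by omega)
      have : 0 < (meet G 1 2 a b).card := Finset.card_pos.2
        ⟨z, mem_meet.2 ⟨hz, by rwa [SimpleGraph.dist_comm]⟩⟩
      positivity
    · intro k hk
      obtain ⟨p, z, hpz⟩ := exists_dist_eq hG.1 hk
      obtain ⟨y, hpy, hyz⟩ := exists_dist_add hG.1 hpz
      have : Nonempty X := ⟨p⟩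
      have hc : (Fintype.card X : ℝ) ≠ 0 := by simp
      have e := congrFun (congrFun (hRe p) y) z
      simp only [Matrix.sub_apply, Matrix.diagonal_mul, Matrix.mul_diagonal] at e
      have hFp : ∀ w l, G.dist p w = l → F 1 w p = (Fintype.card X : ℝ)⁻¹ * θ l := by
        intro w l h
        rw [apply_eq_dualEigenvalue hE, SimpleGraph.dist_comm, h]
      have hsum : ∀ s t l : ℕ, (∀ w, G.dist y w = s → G.dist z w = t → G.dist p w = l) →
          (distMatrix G s * Matrix.diagonal (fun w => F 1 w p) * distMatrix G t) y z =
            (meet G s t y z).card * ((Fintype.card X : ℝ)⁻¹ * θ l) := by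
        intro s t l h
        rw [Matrix.mul_apply, ← nsmul_eq_mul, ← Finset.sum_const, meet, Finset.sum_filter]
        refine Finset.sum_congr rfl fun w _ => ?_
        rw [Matrix.mul_diagonal]
        simp only [distMatrix, Matrix.of_apply, SimpleGraph.dist_comm (u := w) (v := z)]
        split_ifs with h1 h2 h3 h4 h5 <;> try tauto
        all_goals simp_all
      have tri : ∀ w, G.dist p w ≤ k + G.dist y w ∧ k + 3 ≤ G.dist p w + G.dist z w := by
        intro w
        have h1 : G.dist p w ≤ G.dist p y + G.dist y w := hG.1.dist_triangle
        have h2 : G.dist p z ≤ G.dist p w + G.dist w z := hG.1.dist_triangle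
        rw [SimpleGraph.dist_comm (u := w)] at h2
        omega
      rw [hsum 1 2 (k + 1) (fun w h h' => by have := tri w; omega),
        hsum 2 1 (k + 2) (fun w h h' => by have := tri w; omega),
        hFp y k hpy, hFp z (k + 3) hpz,
        apply_eq_of_mem_boseMesner hR (hyz.trans hab.symm)] at e
      have c1 : (meet G 1 2 y z).card = (meet G 1 2 a b).card := hG.2 _ _ _ _ _ _ (hyz.trans hab.symm)
      have c2 : (meet G 2 1 y z).card = (meet G 1 2 a b).card := by
        have : meet G 2 1 y z = meet G 1 2 z y := by ext; simp [mem_meet, and_comm]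
        rw [this]
        exact hG.2 _ _ _ _ _ _ (by rw [SimpleGraph.dist_comm, hyz, hab])
      rw [c1, c2] at e
      have := inv_ne_zero hc
      apply mul_left_cancel₀ this
      linear_combination e
  obtain ⟨m, ρ, hm, hall⟩ := hinst
  have h0 := hall 0 (by omega)
  have h1 := hall j hj
  simp only [zero_add] at h0
  apply mul_left_cancel₀ hm
  linear_combination (θ j - θ (j + 3)) * h0 - (θ 0 - θ 3) * h1

end QPolynomial

/-! ### The span of `J`, `E`, `E ∘ E` as an ideal of the Bose–Mesner algebra. -/

section QuadSpan

variable {X : Type*} [Fintype X] {G : SimpleGraph X}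

/-- The span of `J`, `E` and `E ∘ E`: the matrices whose entries are a fixed quadratic polynomial
in the entries of `E`. -/
def quadSpan (E : Matrix X X ℝ) : Submodule ℝ (Matrix X X ℝ) where
  carrier := {M | ∃ a b c : ℝ, ∀ x y, M x y = a + b * E x y + c * E x y ^ 2}
  zero_mem' := ⟨0, 0, 0, by simp⟩
  add_mem' := by
    rintro M N ⟨a, b, c, h⟩ ⟨a', b', c', h'⟩
    exact ⟨a + a', b + b', c + c', fun x y => by rw [Matrix.add_apply, h, h']; ring⟩
  smul_mem' := by
    rintro t M ⟨a, b, c, h⟩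
    exact ⟨t * a, t * b, t * c, fun x y => by rw [Matrix.smul_apply, h, smul_eq_mul]; ring⟩

variable [DecidableEq X] {F : Fin (G.diam + 1) → Matrix X X ℝ}

/-- Since `q^s_{1,1}` vanishes for `s > 2` and not for `s = 2`, the matrices `J, E, E ∘ E` have the
same span as `E_0, E_1, E_2`. -/
theorem IsQPolynomialOrdering.mem_quadSpan_and (hD : 3 ≤ G.diam)
    (hF : IsQPolynomialOrdering G F) :
    (∀ s : Fin (G.diam + 1), (s : ℕ) ≤ 2 → F s ∈ quadSpan (F 1)) ∧
      ∃ t : Fin (G.diam + 1) → ℝ, F 1 ⊙ F 1 = ∑ s ∈ Finset.univ.filter (fun s : Fin (G.diam + 1) => (s : ℕ) ≤ 2), t s • F s := by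
  obtain ⟨hI, q, hq, hqq⟩ := hF
  have h1 := fin_one_val hD
  have hrep : F 1 ⊙ F 1 =
      ∑ s ∈ Finset.univ.filter (fun s : Fin (G.diam + 1) => (s : ℕ) ≤ 2), ((Fintype.card X : ℝ)⁻¹ * q s 1 1) • F s := by
    rw [hq, Finset.smul_sum, Finset.sum_filter]
    refine Finset.sum_congr rfl fun s _ => ?_
    split_ifs with hs
    · rw [smul_smul]
    · rw [(hqq s 1 1).1 (by rw [h1]; omega)]
      simp
  refine ⟨?_, _, hrep⟩
  have hz : F 0 ∈ quadSpan (F 1) := by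
    rw [hI.trivial_eq]
    exact ⟨(Fintype.card X : ℝ)⁻¹, 0, 0, by simp⟩
  have ho : F 1 ∈ quadSpan (F 1) := ⟨0, 1, 0, by simp⟩
  have hoo : F 1 ⊙ F 1 ∈ quadSpan (F 1) := ⟨0, 0, 1, fun x y => by simp [sq]⟩
  have hlt : 2 < G.diam + 1 := by omega
  have htwo : F ⟨2, hlt⟩ ∈ quadSpan (F 1) := by
    rcases isEmpty_or_nonempty X with hX | hX
    · exact ⟨0, 0, 0, fun x => hX.elim x⟩
    have hc : (Fintype.card X : ℝ) ≠ 0 := by simp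
    have hne : q ⟨2, hlt⟩ 1 1 ≠ 0 := (hqq _ _ _).2 (by
      left
      change 2 = ((1 : Fin (G.diam + 1)) : ℕ) + ((1 : Fin (G.diam + 1)) : ℕ)
      omega)
    have hmem : (⟨2, hlt⟩ : Fin (G.diam + 1)) ∈
        Finset.univ.filter (fun s : Fin (G.diam + 1) => (s : ℕ) ≤ 2) :=
      Finset.mem_filter.2 ⟨Finset.mem_univ _, le_rfl⟩
    rw [← Finset.add_sum_erase _ _ hmem] at hrep
    rw [← Submodule.smul_mem_iff _ (mul_ne_zero (inv_ne_zero hc) hne), eq_sub_of_add_eq hrep.symm]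
    refine sub_mem hoo (Submodule.sum_mem _ fun s hs => Submodule.smul_mem _ _ ?_)
    simp only [Finset.mem_erase, Finset.mem_filter, Finset.mem_univ, true_and] at hs
    have hs2 : (s : ℕ) ≠ 2 := fun e => hs.1 (Fin.ext e)
    have : (s : ℕ) = 0 ∨ (s : ℕ) = 1 := by omega
    rcases this with h | h
    · rwa [show s = 0 from Fin.ext h]
    · rwa [show s = 1 from Fin.ext (h.trans h1.symm)]
  intro s hs
  have : (s : ℕ) = 0 ∨ (s : ℕ) = 1 ∨ (s : ℕ) = 2 := by omega
  rcases this with h | h | h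
  · rwa [show s = 0 from Fin.ext h]
  · rwa [show s = 1 from Fin.ext (h.trans h1.symm)]
  · rwa [show s = ⟨2, hlt⟩ from Fin.ext h]

theorem IsQPolynomialOrdering.mul_mem_quadSpan (hD : 3 ≤ G.diam)
    (hF : IsQPolynomialOrdering G F) {A : Matrix X X ℝ} (hA : A ∈ boseMesner G) :
    A * F 1 ∈ quadSpan (F 1) ∧ A * (F 1 ⊙ F 1) ∈ quadSpan (F 1) := by
  obtain ⟨t, rfl⟩ := hF.1.exists_coeff hA
  obtain ⟨hs, u, hu⟩ := hF.mem_quadSpan_and hD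
  constructor
  · rw [hF.1.sum_smul_mul]
    exact Submodule.smul_mem _ _ ⟨0, 1, 0, by simp⟩
  · rw [hu, Finset.mul_sum]
    refine Submodule.sum_mem _ fun s hs' => ?_
    rw [mul_smul_comm, hF.1.sum_smul_mul]
    exact Submodule.smul_mem _ _ (Submodule.smul_mem _ _ (hs s (Finset.mem_filter.1 hs').2))

theorem IsQPolynomialOrdering.mem_quadSpan_of_orthogonal (hD : 3 ≤ G.diam)
    (hF : IsQPolynomialOrdering G F) {W : Matrix X X ℝ} (hW : W ∈ boseMesner G)
    (h : ∀ s : Fin (G.diam + 1), 3 ≤ (s : ℕ) → ∑ x, ∑ y, W x y * F s x y = 0) :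
    W ∈ quadSpan (F 1) := by
  obtain ⟨t, rfl⟩ := hF.1.exists_coeff hW
  refine Submodule.sum_mem _ fun s _ => ?_
  rcases Nat.lt_or_ge (s : ℕ) 3 with hs | hs
  · exact Submodule.smul_mem _ _ ((hF.mem_quadSpan_and hD).1 s (by omega))
  · have h2 := h s hs
    have h3 : ∀ M : Matrix X X ℝ, ∑ x, ∑ y, M x y * F s x y = (M * F s).trace := by
      intro M
      simp only [Matrix.trace, Matrix.diag, Matrix.mul_apply]
      exact Finset.sum_congr rfl fun x _ => Finset.sum_congr rfl fun y _ => by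
        rw [hF.1.apply_comm s x y]
    rw [h3, hF.1.sum_smul_mul, Matrix.trace_smul, smul_eq_mul, mul_eq_zero] at h2
    rcases h2 with h2 | h2
    · rw [h2, zero_smul]
      exact zero_mem _
    · exfalso
      apply hF.1.linearIndependent.ne_zero s
      have h4 : F s = (F s)ᴴ * F s := by
        rw [Matrix.conjTranspose_eq_transpose_of_trivial, hF.1.symm, hF.1.mul_eq, if_pos rfl]
      rw [h4] at h2
      exact (Matrix.trace_conjTranspose_mul_self_eq_zero_iff).1 h2

/-- A sum of a quadratic expression over the neighbours of a vertex is again quadratic. -/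
theorem IsQPolynomialOrdering.exists_quad_sum_neighbors (hD : 3 ≤ G.diam) (hG : IsDistanceRegular G)
    (hF : IsQPolynomialOrdering G F) (f g h : ℝ) :
    ∃ a b c : ℝ, ∀ j, j ≤ G.diam →
      let θ := dualEigenvalue G (F 1)
      let ψ := fun m => (θ m - θ j) * (f + g * θ m + h * θ j)
      cNum G j * ψ (j - 1) + aNum G j * ψ j + bNum G j * ψ (j + 1) = a + b * θ j + c * θ j ^ 2 := by
  set θ := dualEigenvalue G (F 1) with hθ
  have hE := hF.1.mem 1
  obtain ⟨t, ht⟩ := hF.1.exists_coeff (distMatrix_mem_boseMesner hG.1 1)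
  obtain ⟨a, b, c, h2⟩ := (hF.mul_mem_quadSpan hD (distMatrix_mem_boseMesner hG.1 1)).2
  have h1 : distMatrix G 1 * F 1 = t 1 • F 1 := by rw [← ht, hF.1.sum_smul_mul]
  obtain ⟨x₀, -, -⟩ := exists_dist_eq hG.1 (Nat.zero_le G.diam)
  have : Nonempty X := ⟨x₀⟩
  have hc : (Fintype.card X : ℝ) ≠ 0 := by simp
  set n : ℝ := (Fintype.card X : ℝ) with hn
  have hnb : ∀ (M : Matrix X X ℝ) x y, (distMatrix G 1 * M) x y = ∑ w with G.dist x w = 1, M w y := by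
    intro M x y
    rw [Matrix.mul_apply, Finset.sum_filter]
    exact Finset.sum_congr rfl fun w _ => by simp [distMatrix]
  have hEθ : ∀ w y, n * F 1 w y = θ (G.dist y w) := fun w y => by
    rw [SimpleGraph.dist_comm, hθ, dualEigenvalue_dist hE]
  have s1 : ∀ x y, ∑ w with G.dist x w = 1, θ (G.dist y w) = t 1 * θ (G.dist y x) := by
    intro x y
    have e := congrFun (congrFun h1 x) y
    rw [hnb, Matrix.smul_apply, smul_eq_mul] at e
    simp only [← hEθ]
    rw [← Finset.mul_sum, e]
    ring
  have s2 : ∀ x y, ∑ w with G.dist x w = 1, θ (G.dist y w) ^ 2 =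
      n ^ 2 * a + n * b * θ (G.dist y x) + c * θ (G.dist y x) ^ 2 := by
    intro x y
    have e := h2 x y
    rw [hnb] at e
    simp only [← hEθ, mul_pow]
    rw [← Finset.mul_sum]
    simp only [Matrix.hadamard_apply, ← sq] at e
    rw [e]
    ring
  have s0 : ∀ x : X, ∑ w with G.dist x w = 1, (1 : ℝ) = bNum G 0 := by
    intro x
    have := sum_neighbors hG (fun _ => 1) (SimpleGraph.dist_self (G := G) (v := x))
    rw [this, cNum_zero hG, aNum_zero hG]
    simp
  refine ⟨g * (n ^ 2 * a), f * t 1 - f * bNum G 0 + g * (n * b),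
    g * c + (h - g) * t 1 - h * bNum G 0, ?_⟩
  intro j hj
  obtain ⟨x, y, hxy⟩ := exists_dist_eq hG.1 hj
  simp only
  rw [← sum_neighbors hG (fun m => (θ m - θ j) * (f + g * θ m + h * θ j)) hxy]
  -- Expanded in powers of `θ m`, the sum needs only the moments `s0`, `s1`, `s2`. The first moment
  -- is a multiple of `θ j`, so its product with `θ j` is still quadratic.
  have e : ∀ m, (θ m - θ j) * (f + g * θ m + h * θ j) =
      g * θ m ^ 2 + (f + (h - g) * θ j) * θ m + (-(f * θ j) - h * θ j ^ 2) * 1 := fun m => by ring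
  simp only [e, Finset.sum_add_distrib, ← Finset.mul_sum, s1, s2, s0,
    SimpleGraph.dist_comm (u := y) (v := x), hxy]
  ring

end QuadSpan

/-! ### Counting kites and triangles in a reinforced graph. -/

section Kites

variable {X : Type*} [Fintype X] {G : SimpleGraph X}

theorem sum_triples_comm (j : ℕ) (f : X → X → X → ℝ) :
    ∑ x, ∑ y, (if G.dist x y = j then ∑ w ∈ meet G 1 (j - 1) x y, f x y w else 0) =
      ∑ y, ∑ w, (if G.dist y w = j - 1 then ∑ x ∈ meet G j 1 y w, f x y w else 0) := by
  have e1 : ∀ x y, (if G.dist x y = j then ∑ w ∈ meet G 1 (j - 1) x y, f x y w else 0) =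
      ∑ w, if G.dist x y = j ∧ G.dist x w = 1 ∧ G.dist y w = j - 1 then f x y w else 0 := by
    intro x y
    split_ifs with h
    · rw [meet, Finset.sum_filter]
      exact Finset.sum_congr rfl fun w _ => by simp only [h, true_and]
    · simp [h]
  have e2 : ∀ y w, (if G.dist y w = j - 1 then ∑ x ∈ meet G j 1 y w, f x y w else 0) =
      ∑ x, if G.dist x y = j ∧ G.dist x w = 1 ∧ G.dist y w = j - 1 then f x y w else 0 := by
    intro y w
    split_ifs with h
    · rw [meet, Finset.sum_filter]
      refine Finset.sum_congr rfl fun x _ => ?_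
      rw [SimpleGraph.dist_comm (u := y), SimpleGraph.dist_comm (u := w)]
      simp only [h, and_true]
    · simp [h]
  simp only [e1, e2]
  rw [Finset.sum_comm]
  exact Finset.sum_congr rfl fun y _ => Finset.sum_comm

theorem sum_pairs_const (hG : IsDistanceRegular G) (j : ℕ) (t : ℝ) :
    ∑ x, ∑ y, (if G.dist x y = j then t else 0) = Fintype.card X * kNum G j * t := by
  have : ∀ x, ∑ y, (if G.dist x y = j then t else 0) = kNum G j * t := by
    intro x
    rw [kNum, interNum_eq' hG _ _ (SimpleGraph.dist_self (G := G) (v := x)), ← Finset.sum_filter,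
      Finset.sum_const, nsmul_eq_mul, meet]
    simp
  simp only [this, Finset.sum_const, Finset.card_univ, nsmul_eq_mul]
  ring

theorem card_mul_kNum_pos (hG : IsDistanceRegular G) {j : ℕ} (hj : j ≤ G.diam) :
    (0 : ℝ) < Fintype.card X * kNum G j := by
  obtain ⟨x, y, hxy⟩ := exists_dist_eq hG.1 hj
  have : Nonempty X := ⟨x⟩
  have h1 : 0 < Fintype.card X := Fintype.card_pos
  have h2 : 0 < kNum G j := by
    rw [kNum, interNum_eq' hG _ _ (SimpleGraph.dist_self (G := G) (v := x))]
    exact Finset.card_pos.2 ⟨y, mem_meet.2 ⟨hxy, hxy⟩⟩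
  positivity

theorem sum_meet_const (hG : IsDistanceRegular G) {x y : X} {h : ℕ} (hxy : G.dist x y = h)
    (i j : ℕ) (t : ℝ) : ∑ _w ∈ meet G i j x y, t = interNum G h i j * t := by
  rw [Finset.sum_const, nsmul_eq_mul, interNum_eq' hG _ _ hxy]

theorem meet_swap (i j : ℕ) (x y : X) : meet G i j x y = meet G j i y x := by
  ext
  simp [mem_meet, and_comm]

theorem interNum_swap (hG : IsDistanceRegular G) {h : ℕ} (hh : h ≤ G.diam) (i j : ℕ) :
    interNum G h i j = interNum G h j i := by
  obtain ⟨x, y, hxy⟩ := exists_dist_eq hG.1 hh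
  rw [interNum_eq' hG i j hxy, interNum_eq' hG j i (SimpleGraph.dist_comm.trans hxy), meet_swap]

theorem card_kites (j : ℕ) :
    (Nat.card {t : X × X × X × X // IsKite G j t.1 t.2.1 t.2.2.1 t.2.2.2} : ℝ) =
      ∑ x, ∑ y, (if G.dist x y = j then
        ∑ w ∈ meet G 1 (j - 1) x y, (kiteFun G j x y w : ℝ) else 0) := by
  classical
  rw [Nat.card_eq_fintype_card, Fintype.card_subtype, Finset.card_filter]
  push_cast
  rw [Fintype.sum_prod_type]
  refine Finset.sum_congr rfl fun x _ => ?_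
  rw [Fintype.sum_prod_type]
  refine Finset.sum_congr rfl fun y _ => ?_
  rw [Fintype.sum_prod_type]
  split_ifs with h
  · rw [meet, Finset.sum_filter]
    refine Finset.sum_congr rfl fun z _ => ?_
    split_ifs with h2
    · rw [kiteFun, Finset.card_filter]
      push_cast
      refine Finset.sum_congr rfl fun w _ => ?_
      simp [IsKite, h, h2]
    · refine Finset.sum_eq_zero fun w _ => ?_
      rw [if_neg]
      rintro ⟨-, h3, h4, -⟩
      exact h2 ⟨h3, h4⟩
  · refine Finset.sum_eq_zero fun z _ => Finset.sum_eq_zero fun w _ => ?_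
    rw [if_neg]
    rintro ⟨h3, -⟩
    exact h h3

theorem kiteFun_one (hG : G.Connected) {x y w : X} (hw : G.dist y w = 0) :
    kiteFun G 1 x y w = 0 := by
  rw [kiteFun, Finset.card_eq_zero, Finset.eq_empty_iff_forall_notMem]
  intro v hv
  obtain ⟨-, h1, h2⟩ := (Finset.mem_filter.1 hv).2
  rw [hG.dist_eq_zero_iff] at hw
  subst hw
  omega

/-- This boundary value lets the kite identities hold from `j = 1` on and starts the recurrence for
the kite numbers. -/
theorem kiteNumber_one (hG : G.Connected) : kiteNumber G 1 = 0 := by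
  rw [kiteNumber, card_kites, Finset.sum_eq_zero, zero_div]
  refine fun x _ => Finset.sum_eq_zero fun y _ => ?_
  split_ifs
  · refine Finset.sum_eq_zero fun w hw => ?_
    rw [kiteFun_one hG (mem_meet.1 hw).2, Nat.cast_zero]
  · rfl

theorem kNum_mul_cNum (hG : IsDistanceRegular G) {j : ℕ} (hj : 1 ≤ j) (hjD : j ≤ G.diam) :
    (Fintype.card X * kNum G j * cNum G j : ℝ) =
      Fintype.card X * kNum G (j - 1) * bNum G (j - 1) := by
  have h := sum_triples_comm (G := G) j fun _ _ _ => 1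
  have e1 : ∀ x y, (if G.dist x y = j then ∑ _w ∈ meet G 1 (j - 1) x y, (1 : ℝ) else 0) =
      if G.dist x y = j then (cNum G j : ℝ) else 0 := by
    intro x y
    split_ifs with h
    · rw [sum_meet_const hG h, mul_one, cNum]
    · rfl
  have e2 : ∀ y w, (if G.dist y w = j - 1 then ∑ _x ∈ meet G j 1 y w, (1 : ℝ) else 0) =
      if G.dist y w = j - 1 then (bNum G (j - 1) : ℝ) else 0 := by
    intro y w
    split_ifs with h
    · rw [sum_meet_const hG h, mul_one, bNum, interNum_swap hG (by omega), Nat.sub_add_cancel hj]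
    · rfl
  simp only [e1, e2, sum_pairs_const hG] at h
  exact h

/-- In a reinforced graph the average of the kite function over its last argument is the kite
number. -/
theorem sum_kiteFun_right (hG : IsDistanceRegular G) (hR : IsReinforced G) {j : ℕ} (hj : 1 ≤ j)
    (hjD : j ≤ G.diam) {x y : X} (hxy : G.dist x y = j) :
    ∑ w ∈ meet G 1 (j - 1) x y, (kiteFun G j x y w : ℝ) = cNum G j * kiteNumber G j := by
  rcases hj.eq_or_lt with rfl | hj2
  · rw [kiteNumber_one hG.1, mul_zero]
    refine Finset.sum_eq_zero fun w hw => ?_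
    rw [kiteFun_one hG.1 (mem_meet.1 hw).2, Nat.cast_zero]
  have hc : (cNum G j : ℝ) ≠ 0 := by exact_mod_cast (cNum_pos hG hj hjD).ne'
  have hS : ∀ x' y', G.dist x' y' = j → ∑ w ∈ meet G 1 (j - 1) x' y', (kiteFun G j x' y' w : ℝ) =
      ∑ w ∈ meet G 1 (j - 1) x y, (kiteFun G j x y w : ℝ) := by
    intro x' y' h
    exact mul_left_cancel₀ (inv_ne_zero hc) ((hR j hj2 hjD).1 x' y' x y h hxy)
  have e1 : ∀ x' y', (if G.dist x' y' = j then
      ∑ w ∈ meet G 1 (j - 1) x' y', (kiteFun G j x' y' w : ℝ) else 0) =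
      if G.dist x' y' = j then ∑ w ∈ meet G 1 (j - 1) x y, (kiteFun G j x y w : ℝ) else 0 := by
    intro x' y'
    split_ifs with h
    · exact hS x' y' h
    · rfl
  have hk := (card_mul_kNum_pos hG hjD).ne'
  have hk1 := left_ne_zero_of_mul hk
  have hk2 := right_ne_zero_of_mul hk
  rw [kiteNumber, card_kites]
  simp only [e1, sum_pairs_const hG]
  field_simp

/-- The same kites are summed over their first vertex instead. The averages share the same
normalisation because `|X| k_{j+1} c_{j+1} = |X| k_j b_j`. -/
theorem sum_kiteFun_left (hG : IsDistanceRegular G) (hR : IsReinforced G) {j : ℕ}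
    (hjD : j + 1 ≤ G.diam) {y w : X} (hyw : G.dist y w = j) :
    ∑ x ∈ meet G (j + 1) 1 y w, (kiteFun G (j + 1) x y w : ℝ) =
      bNum G j * kiteNumber G (j + 1) := by
  rcases Nat.eq_zero_or_pos j with rfl | hj
  · rw [zero_add, kiteNumber_one hG.1, mul_zero]
    refine Finset.sum_eq_zero fun x _ => ?_
    rw [kiteFun_one hG.1 hyw, Nat.cast_zero]
  have hb : (bNum G j : ℝ) ≠ 0 := by exact_mod_cast (bNum_pos hG hjD).ne'
  have hS : ∀ y' w', G.dist y' w' = j →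
      ∑ x ∈ meet G (j + 1) 1 y' w', (kiteFun G (j + 1) x y' w' : ℝ) =
      ∑ x ∈ meet G (j + 1) 1 y w, (kiteFun G (j + 1) x y w : ℝ) := by
    intro y' w' h
    exact mul_left_cancel₀ (inv_ne_zero hb) ((hR (j + 1) (by omega) hjD).2 y' w' y w h hyw)
  have e1 : ∀ y' w', (if G.dist y' w' = j then
      ∑ x ∈ meet G (j + 1) 1 y' w', (kiteFun G (j + 1) x y' w' : ℝ) else 0) =
      if G.dist y' w' = j then
        ∑ x ∈ meet G (j + 1) 1 y w, (kiteFun G (j + 1) x y w : ℝ) else 0 := by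
    intro y' w'
    split_ifs with h
    · exact hS y' w' h
    · rfl
  have hk := (card_mul_kNum_pos hG (show j ≤ G.diam by omega)).ne'
  have hk1 := left_ne_zero_of_mul hk
  have hk2 := right_ne_zero_of_mul hk
  rw [kiteNumber, card_kites, sum_triples_comm, kNum_mul_cNum hG (by omega) hjD]
  simp only [Nat.add_sub_cancel, e1, sum_pairs_const hG]
  field_simp

/-- The summand at `y` is the sum over the neighbours `w` of `y` of an antisymmetric function of
`(y, w)`, so the two orientations of each edge cancel. -/
theorem sum_telescope (hG : IsDistanceRegular G) (u : ℕ → ℝ) (r : X) :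
    ∑ y, (cNum G (G.dist r y) * u (G.dist r y) - bNum G (G.dist r y) * u (G.dist r y + 1)) = 0 := by
  let τ : ℕ → ℕ → ℝ := fun a b => if b + 1 = a then u a else if a + 1 = b then -u b else 0
  have hτ : ∀ a b, τ a b = -τ b a := by
    intro a b
    simp only [τ]
    split_ifs <;> first | omega | simp
  have h1 : ∀ y, cNum G (G.dist r y) * u (G.dist r y) - bNum G (G.dist r y) * u (G.dist r y + 1) =
      ∑ w, if G.dist y w = 1 then τ (G.dist r y) (G.dist r w) else 0 := by
    intro y
    rw [← Finset.sum_filter, sum_neighbors hG (τ (G.dist r y)) (SimpleGraph.dist_comm (u := y))]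
    rcases Nat.eq_zero_or_pos (G.dist r y) with h | h
    · rw [h, cNum_zero hG, aNum_zero hG]
      simp [τ]
    · simp only [τ]
      generalize G.dist r y = j at h
      rw [if_pos (show j - 1 + 1 = j by omega), if_neg (show ¬ j + 1 = j by omega),
        if_neg (show ¬ j + 1 = j by omega), if_neg (show ¬ j + 1 + 1 = j by omega), if_pos trivial]
      ring
  have h2 : ∑ y, ∑ w, (if G.dist y w = 1 then τ (G.dist r y) (G.dist r w) else 0) =
      -∑ y, ∑ w, (if G.dist y w = 1 then τ (G.dist r y) (G.dist r w) else 0) := by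
    conv_lhs => rw [Finset.sum_comm]
    simp only [← Finset.sum_neg_distrib]
    refine Finset.sum_congr rfl fun y _ => Finset.sum_congr rfl fun w _ => ?_
    rw [SimpleGraph.dist_comm, hτ]
    split_ifs <;> simp
  simp only [h1]
  linarith

/-- The sum of `(θ_p - θ_j)(θ_q - θ_j)` over the triangles `r, p, q`, where `j` is the distance of
`r` and `y`, and `p`, `q` contribute the values of `θ` at their distance from `y`. -/
theorem sum_triangles (hG : IsDistanceRegular G) (hR : IsReinforced G) (θ : ℕ → ℝ) {r y : X} {j : ℕ}
    (h : G.dist r y = j) :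
    ∑ p with G.dist r p = 1, ∑ q with G.dist r q = 1 ∧ G.dist p q = 1,
        (θ (G.dist y p) - θ j) * (θ (G.dist y q) - θ j) =
      cNum G j * kiteNumber G j * (θ (j - 1) - θ j) ^ 2 +
        bNum G j * (aNum G 1 - kiteNumber G (j + 1)) * (θ (j + 1) - θ j) ^ 2 := by
  have hjD : j ≤ G.diam := h ▸ dist_le_diam hG.1 r y
  rw [sum_neighbors_split hG _ h]
  have hmid : ∑ p ∈ meet G 1 j r y, ∑ q with G.dist r q = 1 ∧ G.dist p q = 1,
        (θ (G.dist y p) - θ j) * (θ (G.dist y q) - θ j) = 0 := by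
    refine Finset.sum_eq_zero fun p hp => Finset.sum_eq_zero fun q _ => ?_
    rw [(mem_meet.1 hp).2, sub_self, zero_mul]
  have hnear : ∀ p q, G.dist r q = 1 → G.dist p q = 1 →
      G.dist y q ≤ G.dist y p + 1 ∧ G.dist y p ≤ G.dist y q + 1 ∧ G.dist y q ≤ j + 1 ∧
        j ≤ G.dist y q + 1 := by
    intro p q h1 h2
    have e1 := dist_near hG.1 h1 y
    have e2 := dist_near hG.1 h2 y
    rw [SimpleGraph.dist_comm (u := y) (v := r), h] at e1
    omega
  have hlow : ∑ p ∈ meet G 1 (j - 1) r y, ∑ q with G.dist r q = 1 ∧ G.dist p q = 1,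
        (θ (G.dist y p) - θ j) * (θ (G.dist y q) - θ j) =
      cNum G j * kiteNumber G j * (θ (j - 1) - θ j) ^ 2 := by
    rcases Nat.eq_zero_or_pos j with rfl | hj
    -- For `j = 0` the index `j - 1` is `0`, so this is the sum treated in `hmid`.
    · rw [hmid, cNum_zero hG]
      simp
    rw [← sum_kiteFun_right hG hR hj hjD h, Finset.sum_mul]
    refine Finset.sum_congr rfl fun p hp => ?_
    rw [(mem_meet.1 hp).2, kiteFun, ← nsmul_eq_mul, ← Finset.sum_const]
    rw [Finset.sum_filter, Finset.sum_filter]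
    refine Finset.sum_congr rfl fun q _ => ?_
    have hp2 := (mem_meet.1 hp).2
    by_cases hq : G.dist r q = 1 ∧ G.dist p q = 1
    · have := hnear p q hq.1 hq.2
      rw [if_pos hq]
      by_cases hq2 : G.dist y q = j - 1
      · rw [if_pos ⟨hq.1, hq2, hq.2⟩, hq2]
        ring
      · rw [if_neg (fun e => hq2 e.2.1), show G.dist y q = j by omega]
        ring
    · rw [if_neg hq, if_neg (fun e => hq ⟨e.1, e.2.2⟩)]
  have hhigh : ∑ p ∈ meet G 1 (j + 1) r y, ∑ q with G.dist r q = 1 ∧ G.dist p q = 1,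
        (θ (G.dist y p) - θ j) * (θ (G.dist y q) - θ j) =
      bNum G j * (aNum G 1 - kiteNumber G (j + 1)) * (θ (j + 1) - θ j) ^ 2 := by
    rcases hjD.eq_or_lt with hjD | hjD
    · have h0 : meet G 1 (j + 1) r y = ∅ := by
        rw [← Finset.card_eq_zero, ← interNum_eq' hG _ _ h]
        exact hjD ▸ bNum_diam hG
      rw [h0, hjD, bNum_diam hG]
      simp
    -- Of the `a_1` common neighbours of `r` and `p`, those counted by the kite function lie at
    -- distance `j` from `y` and contribute zero. The others lie at distance `j + 1`.
    have hb : (bNum G j : ℝ) * (aNum G 1 - kiteNumber G (j + 1)) =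
        ∑ p ∈ meet G 1 (j + 1) r y, ((aNum G 1 : ℝ) - kiteFun G (j + 1) p y r) := by
      rw [Finset.sum_sub_distrib, sum_meet_const hG h, meet_swap,
        sum_kiteFun_left hG hR hjD (SimpleGraph.dist_comm.trans h), mul_sub]
      rfl
    rw [hb, Finset.sum_mul]
    refine Finset.sum_congr rfl fun p hp => ?_
    obtain ⟨hp1, hp2⟩ := mem_meet.1 hp
    rw [hp2, aNum, interNum_eq' hG _ _ hp1, kiteFun, meet, Finset.card_filter, Finset.card_filter]
    push_cast
    rw [← Finset.sum_sub_distrib, Finset.sum_mul, Finset.sum_filter]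
    refine Finset.sum_congr rfl fun q _ => ?_
    rw [SimpleGraph.dist_comm (u := p)]
    by_cases hq : G.dist r q = 1 ∧ G.dist q p = 1
    · have hq' := hq
      rw [SimpleGraph.dist_comm (u := q)] at hq'
      have := hnear p q hq'.1 hq'.2
      rw [if_pos hq, if_pos hq]
      by_cases hq2 : G.dist y q = j
      · rw [if_pos ⟨hq.2, by omega, hq.1⟩, hq2]
        ring
      · rw [if_neg (fun e => hq2 (by omega)), show G.dist y q = j + 1 by omega]
        ring
    · rw [if_neg hq, if_neg hq, if_neg (fun e => hq ⟨e.2.2, e.1⟩)]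
      ring
  rw [hlow, hmid, hhigh, add_zero]

end Kites

/-! ### Kite numbers in terms of `z_2`. -/

section KiteFormula

variable {X : Type*} [Fintype X] {G : SimpleGraph X}

theorem sum_common_neighbors_const (hG : IsDistanceRegular G) (r : X) (φ : X → ℝ) :
    ∑ p with G.dist r p = 1, ∑ _q with G.dist r _q = 1 ∧ G.dist p _q = 1, φ p =
      aNum G 1 * ∑ p with G.dist r p = 1, φ p := by
  rw [Finset.mul_sum]
  refine Finset.sum_congr rfl fun p hp => ?_
  rw [← meet, sum_meet_const hG (Finset.mem_filter.1 hp).2, aNum]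

theorem sum_common_neighbors_swap (r : X) (φ : X → X → ℝ) :
    ∑ p with G.dist r p = 1, ∑ q with G.dist r q = 1 ∧ G.dist p q = 1, φ p q =
      ∑ p with G.dist r p = 1, ∑ q with G.dist r q = 1 ∧ G.dist p q = 1, φ q p := by
  refine Finset.sum_comm' fun p q => ?_
  simp only [Finset.mem_filter, Finset.mem_univ, true_and, SimpleGraph.dist_comm (u := q)]
  tauto

variable [DecidableEq X] {F : Fin (G.diam + 1) → Matrix X X ℝ}

/-- The triangle matrix `W` has entries depending only on distance by `sum_triangles`. It is
orthogonal to `E_s` for `s ≥ 3` by the vanishing of `q^1_{1,s}`, applied to each edge `p, q`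
separately, so it lies in `quadSpan`. -/
theorem IsQPolynomialOrdering.exists_quad_kites (hD : 3 ≤ G.diam) (hG : IsDistanceRegular G)
    (hR : IsReinforced G) (hF : IsQPolynomialOrdering G F) :
    ∃ a b c : ℝ, ∀ j, j ≤ G.diam →
      let θ := dualEigenvalue G (F 1)
      cNum G j * kiteNumber G j * (θ (j - 1) - θ j) ^ 2 +
        bNum G j * (aNum G 1 - kiteNumber G (j + 1)) * (θ (j + 1) - θ j) ^ 2 =
          a + b * θ j + c * θ j ^ 2 := by
  set θ := dualEigenvalue G (F 1) with hθ
  have hE := hF.1.mem 1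
  obtain ⟨x₀, -, -⟩ := exists_dist_eq hG.1 (Nat.zero_le G.diam)
  have : Nonempty X := ⟨x₀⟩
  have hc : (Fintype.card X : ℝ) ≠ 0 := by simp
  set n : ℝ := (Fintype.card X : ℝ) with hn
  let W : Matrix X X ℝ := Matrix.of fun r y => ∑ p with G.dist r p = 1,
    ∑ q with G.dist r q = 1 ∧ G.dist p q = 1, θ (G.dist y p) * θ (G.dist y q)
  let T : ℕ → ℝ := fun j => cNum G j * kiteNumber G j * (θ (j - 1) - θ j) ^ 2 +
        bNum G j * (aNum G 1 - kiteNumber G (j + 1)) * (θ (j + 1) - θ j) ^ 2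
  -- This corrects `θ_p θ_q` to `(θ_p - θ_j)(θ_q - θ_j)`: after symmetrising in `p, q`, the
  -- difference is `2 θ_j θ_p - θ_j²`, which is `ψ j` plus `θ_j²`.
  let ψ : ℕ → ℕ → ℝ := fun j m => (θ m - θ j) * (0 + 0 * θ m + 2 * θ j)
  have hW : ∀ r y, W r y = T (G.dist r y) + aNum G 1 * ((cNum G (G.dist r y) *
      ψ (G.dist r y) (G.dist r y - 1) + aNum G (G.dist r y) * ψ (G.dist r y) (G.dist r y) +
      bNum G (G.dist r y) * ψ (G.dist r y) (G.dist r y + 1)) +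
      bNum G 0 * θ (G.dist r y) ^ 2) := by
    intro r y
    generalize hj : G.dist r y = j
    have s0 : ∑ w with G.dist r w = 1, θ j ^ 2 = bNum G 0 * θ j ^ 2 := by
      rw [sum_neighbors hG (fun _ => θ j ^ 2) (SimpleGraph.dist_self (G := G) (v := r)),
        cNum_zero hG, aNum_zero hG]
      simp
    rw [← sum_neighbors hG (ψ j) hj, ← s0]
    simp only [T]
    rw [← sum_triangles hG hR θ hj, ← Finset.sum_add_distrib, ← sum_common_neighbors_const hG]
    have e : ∑ p with G.dist r p = 1, ∑ q with G.dist r q = 1 ∧ G.dist p q = 1,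
        (ψ j (G.dist y p) + θ j ^ 2) =
        ∑ p with G.dist r p = 1, ∑ q with G.dist r q = 1 ∧ G.dist p q = 1,
        (θ (G.dist y p) * θ j + θ j * θ (G.dist y q) - θ j ^ 2) := by
      have : ∑ p with G.dist r p = 1, ∑ q with G.dist r q = 1 ∧ G.dist p q = 1,
          θ j * θ (G.dist y q) = ∑ p with G.dist r p = 1,
            ∑ q with G.dist r q = 1 ∧ G.dist p q = 1, θ j * θ (G.dist y p) :=
        sum_common_neighbors_swap r fun p q => θ j * θ (G.dist y q)
      simp only [Finset.sum_sub_distrib, Finset.sum_add_distrib, this]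
      rw [← Finset.sum_add_distrib, ← Finset.sum_add_distrib, ← Finset.sum_sub_distrib]
      refine Finset.sum_congr rfl fun p _ => ?_
      rw [← Finset.sum_add_distrib, ← Finset.sum_add_distrib, ← Finset.sum_sub_distrib]
      refine Finset.sum_congr rfl fun q _ => ?_
      simp only [ψ]
      ring
    rw [e, ← Finset.sum_add_distrib]
    refine Finset.sum_congr rfl fun p _ => ?_
    rw [← Finset.sum_add_distrib]
    refine Finset.sum_congr rfl fun q _ => ?_
    ring
  have hWB : W ∈ boseMesner G := mem_boseMesner_of_dist hG.1 (fun j => T j + aNum G 1 * ((cNum G j *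
      ψ j (j - 1) + aNum G j * ψ j j + bNum G j * ψ j (j + 1)) + bNum G 0 * θ j ^ 2)) hW
  have horth : ∀ s : Fin (G.diam + 1), 3 ≤ (s : ℕ) → ∑ x, ∑ y, W x y * F s x y = 0 := by
    intro s hs
    obtain ⟨hI, q, hq, hqq⟩ := hF
    have h0 : q 1 1 s = 0 := (hqq 1 1 s).1 (by rw [fin_one_val hD]; omega)
    refine Finset.sum_eq_zero fun r _ => ?_
    simp only [W, Matrix.of_apply, Finset.sum_mul]
    rw [Finset.sum_comm]
    refine Finset.sum_eq_zero fun p _ => ?_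
    rw [Finset.sum_comm]
    refine Finset.sum_eq_zero fun w _ => ?_
    have h1 := hI.sum_mul_mul_eq_zero hq h0 p w r
    simp only [hθ, dualEigenvalue_dist hE]
    rw [← mul_zero (n ^ 2), ← h1, Finset.mul_sum]
    refine Finset.sum_congr rfl fun y _ => ?_
    rw [hI.apply_comm s r y]
    ring
  obtain ⟨a, b, c, habc⟩ := hF.mem_quadSpan_of_orthogonal hD hWB horth
  obtain ⟨a', b', c', h'⟩ := hF.exists_quad_sum_neighbors hD hG 0 0 2
  refine ⟨a - aNum G 1 * a', n⁻¹ * b - aNum G 1 * b', n⁻¹ ^ 2 * c - aNum G 1 * c'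
    - aNum G 1 * bNum G 0, fun j hj => ?_⟩
  obtain ⟨r, y, rfl⟩ := exists_dist_eq hG.1 hj
  have h1 := habc r y
  have h2 := h' _ hj
  rw [hW, apply_eq_dualEigenvalue hE] at h1
  simp only [T, ψ, ← hθ, ← hn] at h1 h2 ⊢
  rw [h2] at h1
  linear_combination h1

/-- The kite numbers of a reinforced graph are determined by the second one. -/
theorem IsQPolynomialOrdering.kiteNumber_formula (hD : 3 ≤ G.diam) (hG : IsDistanceRegular G)
    (hR : IsReinforced G) (hF : IsQPolynomialOrdering G F) {j : ℕ} (hj : 1 ≤ j) (hjD : j ≤ G.diam) :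
    let θ := dualEigenvalue G (F 1)
    (θ 0 - θ 2) * (θ (j - 1) - θ j) * kiteNumber G j =
      (θ 1 - θ 2) * (θ 0 + θ 1 - θ (j - 1) - θ j) * kiteNumber G 2 +
        aNum G 1 * ((θ 0 - θ 1) * (θ 2 - θ j) - (θ 1 - θ 2) * (θ 1 - θ (j - 1))) := by
  set θ := dualEigenvalue G (F 1) with hθ
  simp only
  obtain ⟨r, -, -⟩ := exists_dist_eq hG.1 (Nat.zero_le G.diam)
  have : Nonempty X := ⟨r⟩
  have hc : (Fintype.card X : ℝ) ≠ 0 := by simp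
  set n : ℝ := (Fintype.card X : ℝ) with hn
  have hne : ∀ i j : ℕ, i ≤ G.diam → j ≤ G.diam → i ≠ j → θ i - θ j ≠ 0 := fun i j hi hj hij h =>
    hij (hF.dualEigenvalue_injOn hD hG.1 hi hj (sub_eq_zero.1 h))
  have h0 : θ 0 ≠ 0 := (hF.dualEigenvalue_zero_pos hD hG.1).ne'
  set x := (θ 1 - θ 2) * kiteNumber G 2 with hx
  set a₁ : ℝ := (aNum G 1 : ℝ) with ha₁
  -- `e j` is the defect of the claimed formula, and `u` its weighted form with `u 1 = u 2 = 0`. The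
  -- comparison sequence `v` satisfies the same kind of recurrence with `v 1 = 0` and `v 2 ≠ 0`.
  let e : ℕ → ℝ := fun j => (θ 0 - θ 2) * (θ (j - 1) - θ j) * kiteNumber G j -
    (x * (θ 0 + θ 1 - θ (j - 1) - θ j) +
      a₁ * ((θ 0 - θ 1) * (θ 2 - θ j) - (θ 1 - θ 2) * (θ 1 - θ (j - 1))))
  let u : ℕ → ℝ := fun j => (θ (j - 1) - θ j) * e j
  let v : ℕ → ℝ := fun j => (θ (j - 1) - θ j) * (θ 0 + θ 1 - θ (j - 1) - θ j)
  have hu1 : u 1 = 0 := by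
    simp only [u, e, kiteNumber_one hG.1]
    ring
  have hu2 : u 2 = 0 := by
    simp only [u, e, hx]
    ring
  have hv1 : v 1 = 0 := by
    simp only [v]
    ring
  have hv2 : v 2 ≠ 0 := by
    have h1 := hne 1 2 (by omega) (by omega) (by omega)
    have h2 := hne 0 2 (by omega) (by omega) (by omega)
    have : v 2 = (θ 1 - θ 2) * (θ 0 - θ 2) := by
      simp only [v]
      ring
    rw [this]
    exact mul_ne_zero h1 h2
  obtain ⟨a, b, c, habc⟩ : ∃ a b c : ℝ, ∀ j, j ≤ G.diam →
      cNum G j * u j - bNum G j * u (j + 1) = a + b * θ j + c * θ j ^ 2 := by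
    obtain ⟨a, b, c, h⟩ := hF.exists_quad_kites hD hG hR
    -- These are the coefficients of the explicit part of `e j` in `θ (j - 1)` and `θ j`. For the
    -- `b_j` term the roles of the two are exchanged, which costs `a₁ (θ 0 - θ 2) (θ j - θ (j +
    -- 1))`; this is the `a_1` term of `exists_quad_kites`.
    obtain ⟨a', b', c', h'⟩ := hF.exists_quad_sum_neighbors hD hG
      (x * (θ 0 + θ 1) + a₁ * ((θ 0 - θ 1) * θ 2 - (θ 1 - θ 2) * θ 1))
      (-x + a₁ * (θ 1 - θ 2)) (-x - a₁ * (θ 0 - θ 1))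
    refine ⟨(θ 0 - θ 2) * a - a', (θ 0 - θ 2) * b - b', (θ 0 - θ 2) * c - c', fun j hj => ?_⟩
    have h1 := h j hj
    have h2 := h' j hj
    simp only [← hθ, ← ha₁] at h1 h2
    simp only [u, e, Nat.add_sub_cancel]
    linear_combination (θ 0 - θ 2) * h1 - h2
  obtain ⟨a', b', c', habc'⟩ : ∃ a b c : ℝ, ∀ j, j ≤ G.diam →
      cNum G j * v j - bNum G j * v (j + 1) = a + b * θ j + c * θ j ^ 2 := by
    obtain ⟨a', b', c', h'⟩ := hF.exists_quad_sum_neighbors hD hG (θ 0 + θ 1) (-1) (-1)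
    refine ⟨a', b', c', fun j hj => ?_⟩
    have h2 := h' j hj
    simp only [← hθ] at h2
    simp only [v, Nat.add_sub_cancel]
    linear_combination h2
  have hsum : ∀ a b c : ℝ, ∑ y, (a + b * θ (G.dist r y) + c * θ (G.dist r y) ^ 2) =
      n * a + c * ∑ y, θ (G.dist r y) ^ 2 := by
    intro a b c
    rw [Finset.sum_add_distrib, Finset.sum_add_distrib, ← Finset.mul_sum, ← Finset.mul_sum,
      hF.sum_dualEigenvalue hD r, Finset.sum_const, Finset.card_univ, nsmul_eq_mul]
    ring
  set Q := ∑ y, θ (G.dist r y) ^ 2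
  have hs : n * a + c * Q = 0 := by
    rw [← hsum a b c, ← sum_telescope hG u r]
    exact Finset.sum_congr rfl fun y _ => (habc _ (dist_le_diam hG.1 r y)).symm
  have hs' : n * a' + c' * Q = 0 := by
    rw [← hsum a' b' c', ← sum_telescope hG v r]
    exact Finset.sum_congr rfl fun y _ => (habc' _ (dist_le_diam hG.1 r y)).symm
  have p0 := habc 0 (by omega)
  have p1 := habc 1 (by omega)
  have p0' := habc' 0 (by omega)
  have p1' := habc' 1 (by omega)
  simp only [cNum_zero hG, Nat.cast_zero, zero_add, zero_mul, zero_sub, hu1, hv1, hu2, mul_zero,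
    sub_zero, Nat.reduceAdd] at p0 p1 p0' p1'
  have hb1 : (bNum G 1 : ℝ) ≠ 0 := by exact_mod_cast (bNum_pos hG (by omega)).ne'
  have h01 := hne 0 1 (by omega) (by omega) (by omega)
  have hb : b = -c * (θ 0 + θ 1) := by
    apply mul_left_cancel₀ h01
    linear_combination p1 - p0
  have ha : a = c * (θ 0 * θ 1) := by linear_combination -p0 - θ 0 * hb
  -- The quadratic of `u` vanishes at `θ 0` and `θ 1`, so it is `c (t - θ 0)(t - θ 1)`. If `c ≠ 0`,
  -- its vanishing sum over all vertices forces `Q = -n θ 0 θ 1`. Then the quadratic of `v`, which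
  -- vanishes at `θ 0` and also sums to zero, must vanish at `θ 1` too, contradicting `b_1 v 2 ≠ 0`.
  have hcz : c = 0 := by
    by_contra hcne
    have hQ : Q = -(n * (θ 0 * θ 1)) := by
      apply mul_left_cancel₀ hcne
      linear_combination hs - n * ha
    have ha' : a' = c' * (θ 0 * θ 1) := by
      apply mul_left_cancel₀ hc
      linear_combination hs' - c' * hQ
    have hb' : b' = -c' * (θ 0 + θ 1) := by
      apply mul_left_cancel₀ h0
      linear_combination -p0' - ha'
    rw [ha', hb'] at p1'
    apply mul_ne_zero hb1 hv2
    linear_combination -p1'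
  rw [hcz] at ha hb
  have hrec : ∀ j, 1 ≤ j → j ≤ G.diam → u j = 0 := by
    intro j hj
    induction j, hj using Nat.le_induction with
    | base => exact fun _ => hu1
    | succ j hj ih =>
      intro hjD
      have h1 := habc j (by omega)
      have hbj : (bNum G j : ℝ) ≠ 0 := by exact_mod_cast (bNum_pos hG hjD).ne'
      rw [ih (by omega), ha, hb, hcz] at h1
      apply mul_left_cancel₀ hbj
      linear_combination -h1
  have hej := hrec j hj hjD
  have := (mul_eq_zero.1 hej).resolve_left (hne (j - 1) j (by omega) hjD (by omega))
  simp only [e, hx] at this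
  linear_combination this

end KiteFormula

/-! ### Gram determinants and the identities that evaluate their entries. -/

section Gram

theorem dotProduct_sq_le {ι : Type*} [Fintype ι] (u v : ι → ℝ) :
    0 ≤ (u ⬝ᵥ u) * (v ⬝ᵥ v) - (u ⬝ᵥ v) ^ 2 := by
  have := Finset.sum_mul_sq_le_sq_mul_sq Finset.univ u v
  simp only [dotProduct, ← sq]
  linarith

/-- Four vectors are dependent if and only if the projections of the first two on the orthogonal
complement of the last two are, provided that the last two are independent. -/
theorem not_linearIndependent_four_iff {ι : Type*} [Fintype ι] {u v x y : ι → ℝ} {r s r' s' : ℝ}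
    (hux : (u - r • x - s • y) ⬝ᵥ x = 0) (huy : (u - r • x - s • y) ⬝ᵥ y = 0)
    (hvx : (v - r' • x - s' • y) ⬝ᵥ x = 0) (hvy : (v - r' • x - s' • y) ⬝ᵥ y = 0)
    (hxy : (x ⬝ᵥ x) * (y ⬝ᵥ y) - (x ⬝ᵥ y) ^ 2 ≠ 0) :
    ¬ LinearIndependent ℝ ![u, v, x, y] ↔
      ((u - r • x - s • y) ⬝ᵥ (u - r • x - s • y)) * ((v - r' • x - s' • y) ⬝ᵥ (v - r' • x - s' • y))
        - ((u - r • x - s • y) ⬝ᵥ (v - r' • x - s' • y)) ^ 2 = 0 := by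
  set u' := u - r • x - s • y with hu'
  set v' := v - r' • x - s' • y with hv'
  have hu : u = u' + r • x + s • y := by rw [hu']; abel
  have hv : v = v' + r' • x + s' • y := by rw [hv']; abel
  rw [Fintype.not_linearIndependent_iff]
  constructor
  · rintro ⟨g, hg, i, hi⟩
    rw [Fin.sum_univ_four] at hg
    simp only [Matrix.cons_val] at hg
    have key : ∀ w : ι → ℝ, g 0 * (u ⬝ᵥ w) + g 1 * (v ⬝ᵥ w) + g 2 * (x ⬝ᵥ w) + g 3 * (y ⬝ᵥ w) = 0 := by
      intro w
      have := congrArg (· ⬝ᵥ w) hg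
      simpa only [add_dotProduct, smul_dotProduct, smul_eq_mul, zero_dotProduct] using this
    have hxu : x ⬝ᵥ u' = 0 := by rw [dotProduct_comm, hux]
    have hyu : y ⬝ᵥ u' = 0 := by rw [dotProduct_comm, huy]
    have hxv : x ⬝ᵥ v' = 0 := by rw [dotProduct_comm, hvx]
    have hyv : y ⬝ᵥ v' = 0 := by rw [dotProduct_comm, hvy]
    have k1 := key u'
    have k2 := key v'
    have k3 := key x
    have k4 := key y
    rw [hu, hv] at k1 k2 k3 k4
    simp only [add_dotProduct, smul_dotProduct, smul_eq_mul, hxu, hyu, hxv, hyv, hux, huy, hvx,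
      hvy] at k1 k2 k3 k4
    rw [dotProduct_comm v' u'] at k1
    rw [dotProduct_comm y x] at k3
    by_contra hne
    have g0 : g 0 = 0 := by
      apply (mul_eq_zero.1 (_ : (_ : ℝ) * g 0 = 0)).resolve_left hne
      linear_combination (v' ⬝ᵥ v') * k1 - (u' ⬝ᵥ v') * k2
    have g1 : g 1 = 0 := by
      apply (mul_eq_zero.1 (_ : (_ : ℝ) * g 1 = 0)).resolve_left hne
      linear_combination (u' ⬝ᵥ u') * k2 - (u' ⬝ᵥ v') * k1
    rw [g0, g1] at k3 k4
    have g2 : g 2 = 0 := by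
      apply (mul_eq_zero.1 (_ : (_ : ℝ) * g 2 = 0)).resolve_left hxy
      linear_combination (y ⬝ᵥ y) * k3 - (x ⬝ᵥ y) * k4
    have g3 : g 3 = 0 := by
      apply (mul_eq_zero.1 (_ : (_ : ℝ) * g 3 = 0)).resolve_left hxy
      linear_combination (x ⬝ᵥ x) * k4 - (x ⬝ᵥ y) * k3
    apply hi
    fin_cases i <;> assumption
  · intro h
    by_cases hP : u' ⬝ᵥ u' = 0
    · have h0 : u' = 0 := dotProduct_self_eq_zero.1 hP
      refine ⟨![1, 0, -r, -s], ?_, 0, by simp⟩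
      rw [Fin.sum_univ_four]
      simp only [Matrix.cons_val]
      rw [hu, h0]
      module
    -- The squared norm of this vector is `u' ⬝ᵥ u'` times the vanishing determinant.
    · have h0 : (u' ⬝ᵥ v') • u' - (u' ⬝ᵥ u') • v' = 0 := by
        rw [← dotProduct_self_eq_zero]
        simp only [sub_dotProduct, dotProduct_sub, smul_dotProduct, dotProduct_smul, smul_eq_mul,
          dotProduct_comm v' u']
        linear_combination (u' ⬝ᵥ u') * h
      refine ⟨![u' ⬝ᵥ v', -(u' ⬝ᵥ u'), (u' ⬝ᵥ u') * r' - (u' ⬝ᵥ v') * r,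
        (u' ⬝ᵥ u') * s' - (u' ⬝ᵥ v') * s], ?_, 1, by simpa using hP⟩
      rw [Fin.sum_univ_four]
      simp only [Matrix.cons_val]
      rw [← h0, hu, hv]
      module

variable {X : Type*} {G : SimpleGraph X}

/-- Two neighbours of `x` are at distance 0, 1 or 2, so only the number of adjacent pairs in `S` is
needed. -/
theorem sum_pairs_near (hG : G.Connected) (θ : ℕ → ℝ) {x : X} {S : Finset X}
    (hS : ∀ z ∈ S, G.dist x z = 1) :
    ∑ z ∈ S, ∑ t ∈ S, θ (G.dist z t) = S.card * θ 0 +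
      (∑ z ∈ S, ∑ t ∈ S, (if G.dist z t = 1 then (1 : ℝ) else 0)) * (θ 1 - θ 2) +
      (S.card ^ 2 - S.card) * θ 2 := by
  classical
  have e : ∀ z ∈ S, ∑ t ∈ S, θ (G.dist z t) = (∑ t ∈ S, (if G.dist z t = 1 then (1 : ℝ) else 0)) *
      (θ 1 - θ 2) + ((θ 0 - θ 2) + S.card * θ 2) := by
    intro z hz
    have : ∀ t ∈ S, θ (G.dist z t) = (if G.dist z t = 1 then (1 : ℝ) else 0) * (θ 1 - θ 2) +
        ((if z = t then (θ 0 - θ 2) else 0) + θ 2) := by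
      intro t ht
      have h1 := dist_near hG (hS t ht) z
      rw [SimpleGraph.dist_comm (u := z) (v := x), hS z hz] at h1
      by_cases hzt : z = t
      · subst hzt
        simp
      · have h2 := mt hG.dist_eq_zero_iff.1 hzt
        have : G.dist z t = 1 ∨ G.dist z t = 2 := by omega
        rcases this with h | h <;> simp [h, hzt]
    rw [Finset.sum_congr rfl this, Finset.sum_add_distrib, Finset.sum_add_distrib, ← Finset.sum_mul,
      Finset.sum_ite_eq, if_pos hz, Finset.sum_const, nsmul_eq_mul]
  rw [Finset.sum_congr rfl e, Finset.sum_add_distrib, ← Finset.sum_mul, Finset.sum_const,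
    nsmul_eq_mul]
  ring

variable [Fintype X]

theorem sum_adjacent_pairs (hG : IsDistanceRegular G) (hR : IsReinforced G) {x y : X} {i l : ℕ}
    (h : G.dist x y = i) (hl : l ≠ i) :
    ∑ z ∈ meet G 1 l x y, ∑ t ∈ meet G 1 l x y, (if G.dist z t = 1 then (1 : ℝ) else 0) =
      cNum G i * kiteNumber G i * (if i - 1 = l then 1 else 0) +
        bNum G i * (aNum G 1 - kiteNumber G (i + 1)) * (if i + 1 = l then 1 else 0) := by
  -- With an indicator function in place of `θ`, and `l ≠ i`, the triangle sum counts the adjacent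
  -- pairs.
  have := sum_triangles hG hR (fun m => if m = l then 1 else 0) h
  simp only [if_neg hl.symm, sub_zero, ite_pow, one_pow, ne_eq, OfNat.ofNat_ne_zero,
    not_false_eq_true, zero_pow] at this
  rw [← this]
  simp only [meet, Finset.sum_filter]
  refine Finset.sum_congr rfl fun z _ => ?_
  by_cases h1 : G.dist x z = 1 <;> by_cases h2 : G.dist y z = l <;> simp only [h1, h2, if_true,
    if_false, and_true, and_false, one_mul, zero_mul, ite_self,
    Finset.sum_const_zero]
  refine Finset.sum_congr rfl fun t _ => ?_
  by_cases h3 : G.dist x t = 1 <;> by_cases h4 : G.dist y t = l <;> by_cases h5 : G.dist z t = 1 <;>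
    simp [h3, h4, h5]

variable [DecidableEq X] {F : Fin (G.diam + 1) → Matrix X X ℝ}

theorem IsIdempotentOrdering.mulVec_dotProduct (hF : IsIdempotentOrdering G F)
    (s : Fin (G.diam + 1)) (S T : Finset X) :
    (F s *ᵥ ∑ z ∈ S, Pi.single z 1) ⬝ᵥ (F s *ᵥ ∑ t ∈ T, Pi.single t 1) =
      ∑ z ∈ S, ∑ t ∈ T, F s z t := by
  rw [Matrix.mulVec_sum, Matrix.mulVec_sum, sum_dotProduct]
  refine Finset.sum_congr rfl fun z _ => ?_
  rw [dotProduct_sum]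
  refine Finset.sum_congr rfl fun t _ => ?_
  simp only [Matrix.mulVec_single_one, dotProduct, Matrix.col_apply]
  rw [← hF.sum_apply_mul_apply s z t]
  exact Finset.sum_congr rfl fun w _ => by rw [hF.apply_comm s w z]

theorem IsQPolynomialOrdering.gammaStar_eq (hD : 3 ≤ G.diam) (hG : IsDistanceRegular G)
    (hF : IsQPolynomialOrdering G F) {i : ℕ} (hi : 1 ≤ i) (hiD : i + 1 ≤ G.diam) :
    dualEigenvalue G (F 1) (i - 1) - betaParam G (F 1) * dualEigenvalue G (F 1) i +
      dualEigenvalue G (F 1) (i + 1) = gammaStar G (F 1) := by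
  have hne : dualEigenvalue G (F 1) 1 - dualEigenvalue G (F 1) 2 ≠ 0 := fun h => by
    have := hF.dualEigenvalue_injOn hD hG.1 (by omega) (by omega) (sub_eq_zero.1 h)
    omega
  induction i, hi using Nat.le_induction with
  | base => rfl
  | succ i hi ih =>
    rw [← ih (by omega)]
    obtain ⟨j, rfl⟩ : ∃ j, i = j + 1 := ⟨i - 1, by omega⟩
    have h := hF.recurrence hD hG (show j + 3 ≤ G.diam by omega)
    simp only [Nat.add_sub_cancel]
    have hβ : (betaParam G (F 1) + 1) * (dualEigenvalue G (F 1) 1 - dualEigenvalue G (F 1) 2) =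
        dualEigenvalue G (F 1) 0 - dualEigenvalue G (F 1) 3 := by
      rw [betaParam]
      field_simp
      ring
    apply mul_left_cancel₀ hne
    change _ * (_ - _ * dualEigenvalue G (F 1) (j + 2) + dualEigenvalue G (F 1) (j + 3)) = _
    linear_combination -h +
      (dualEigenvalue G (F 1) (j + 1) - dualEigenvalue G (F 1) (j + 2)) * hβ

/-- This is a first integral of the recurrence `gammaStar_eq`: consecutive values differ by `θ (i +
1) - θ (i - 1)` times the defect of that recurrence. -/
theorem IsQPolynomialOrdering.deltaStar_eq (hD : 3 ≤ G.diam) (hG : IsDistanceRegular G)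
    (hF : IsQPolynomialOrdering G F) {i : ℕ} (hi : 1 ≤ i) (hiD : i ≤ G.diam) :
    let θ := dualEigenvalue G (F 1)
    θ (i - 1) ^ 2 - betaParam G (F 1) * θ (i - 1) * θ i + θ i ^ 2 -
        gammaStar G (F 1) * (θ (i - 1) + θ i) =
      θ 0 ^ 2 - betaParam G (F 1) * θ 0 * θ 1 + θ 1 ^ 2 - gammaStar G (F 1) * (θ 0 + θ 1) := by
  induction i, hi using Nat.le_induction with
  | base => rfl
  | succ i hi ih =>
    have h := hF.gammaStar_eq hD hG hi hiD
    have h2 := ih (by omega)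
    simp only [Nat.add_sub_cancel] at h2 ⊢
    linear_combination h2 + (dualEigenvalue G (F 1) (i + 1) - dualEigenvalue G (F 1) (i - 1)) * h

/-- It evaluates the inner product of the two projected vectors. Eliminating `θ 2` and `θ (i + 1)`
with `gammaStar_eq` leaves `θ 0` times `deltaStar_eq`. -/
theorem IsQPolynomialOrdering.cross_identity (hD : 3 ≤ G.diam) (hG : IsDistanceRegular G)
    (hF : IsQPolynomialOrdering G F) {i : ℕ} (hi : 1 ≤ i) (hiD : i + 1 ≤ G.diam) :
    let θ := dualEigenvalue G (F 1)
    θ 2 * (θ 0 ^ 2 - θ i ^ 2) - (θ 0 * θ 1 - θ (i - 1) * θ i) * θ 1 -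
        (θ 0 * θ (i - 1) - θ 1 * θ i) * θ (i + 1) =
      gammaStar G (F 1) * (θ i - θ 1) * (θ 0 - θ i) := by
  have h1 := hF.gammaStar_eq hD hG le_rfl (show 1 + 1 ≤ G.diam by omega)
  have hi' := hF.gammaStar_eq hD hG hi hiD
  have hd := hF.deltaStar_eq hD hG hi (by omega)
  simp only [Nat.sub_self, Nat.reduceAdd] at h1 hd ⊢
  set θ := dualEigenvalue G (F 1)
  have e1 : θ (i + 1) = gammaStar G (F 1) + betaParam G (F 1) * θ i - θ (i - 1) := by
    linear_combination hi'
  have e2 : θ 2 = gammaStar G (F 1) + betaParam G (F 1) * θ 1 - θ 0 := by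
    linear_combination h1
  rw [e1, e2]
  linear_combination θ 0 * hd

end Gram

/-! ### The Gram determinant equals `Φ_i(z_2)` up to a positive factor. -/

section Main

variable {X : Type*} [Fintype X] [DecidableEq X] {G : SimpleGraph X}
  {F : Fin (G.diam + 1) → Matrix X X ℝ}

theorem IsQPolynomialOrdering.kiteNumber_eq (hD : 3 ≤ G.diam) (hG : IsDistanceRegular G)
    (hR : IsReinforced G) (hF : IsQPolynomialOrdering G F) {j : ℕ} (hj : 1 ≤ j) (hjD : j ≤ G.diam) :
    kiteNumber G j =
      alphaCoeff G (F 1) j * kiteNumber G 2 + aNum G 1 * betaCoeff G (F 1) j := by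
  have hne : ∀ i j : ℕ, i ≤ G.diam → j ≤ G.diam → i ≠ j →
      dualEigenvalue G (F 1) i - dualEigenvalue G (F 1) j ≠ 0 := fun i j hi hj hij h =>
    hij (hF.dualEigenvalue_injOn hD hG.1 hi hj (sub_eq_zero.1 h))
  have h := hF.kiteNumber_formula hD hG hR hj hjD
  have h1 := hne 0 2 (by omega) (by omega) (by omega)
  have h2 := hne (j - 1) j (by omega) (by omega) (by omega)
  simp only [alphaCoeff, betaCoeff] at h ⊢
  field_simp
  linear_combination h

/-- `Φ_i(z_2)` is, up to a positive factor, the Gram determinant of the projections of `E x⁻_y` and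
`E x⁺_y` on the orthogonal complement of `E x̂` and `E ŷ`. -/
theorem IsQPolynomialOrdering.Phi_nonneg_and (hD : 3 ≤ G.diam) (hG : IsDistanceRegular G)
    (hR : IsReinforced G) (hF : IsQPolynomialOrdering G F) {i : ℕ} (hi : 2 ≤ i)
    (hiD : i + 1 ≤ G.diam) {x y : X} (hxy : G.dist x y = i) :
    0 ≤ (Phi G (F 1) i).eval (kiteNumber G 2) ∧
      (FourDependent G (F 1) x y ↔ (Phi G (F 1) i).eval (kiteNumber G 2) = 0) := by
  set θ := dualEigenvalue G (F 1) with hθ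
  have : Nonempty X := ⟨x⟩
  have hn : (Fintype.card X : ℝ) ≠ 0 := by simp
  have hE := hF.1.mem 1
  set n : ℝ := (Fintype.card X : ℝ) with hndef
  set c : ℝ := (cNum G i : ℝ) with hc
  set b : ℝ := (bNum G i : ℝ) with hb
  set a₁ : ℝ := (aNum G 1 : ℝ) with ha₁
  have hcpos : 0 < c := Nat.cast_pos.2 (cNum_pos (i := i) hG (by omega) (by omega))
  have hbpos : 0 < b := Nat.cast_pos.2 (bNum_pos hG hiD)
  have hne : ∀ i j : ℕ, i ≤ G.diam → j ≤ G.diam → i ≠ j → θ i - θ j ≠ 0 := fun i j hi hj hij h =>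
    hij (hF.dualEigenvalue_injOn hD hG.1 hi hj (sub_eq_zero.1 h))
  have h12 := hne 1 2 (by omega) (by omega) (by omega)
  have h0i := hne 0 i (by omega) (by omega) (by omega)
  have hi0 : θ i + θ 0 ≠ 0 := hF.dualEigenvalue_ne_neg hD hG (by omega) hiD
  have hsq : θ 0 ^ 2 - θ i ^ 2 ≠ 0 := by
    have : θ 0 ^ 2 - θ i ^ 2 = (θ 0 - θ i) * (θ i + θ 0) := by ring
    rw [this]
    exact mul_ne_zero h0i hi0
  set Sm := meet G 1 (i - 1) x y with hSm
  set Sp := meet G 1 (i + 1) x y with hSp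
  have hcm : (Sm.card : ℝ) = c := by rw [hc, cNum, interNum_eq' hG _ _ hxy]
  have hcp : (Sp.card : ℝ) = b := by rw [hb, bNum, interNum_eq' hG _ _ hxy]
  have hm : xMinus G x y = ∑ z ∈ Sm, Pi.single z 1 := by
    rw [xMinus, hSm, meet, hxy]
    refine Finset.sum_congr (Finset.filter_congr fun z _ => ?_) fun _ _ => rfl
    rw [show G.dist y z + 1 = i ↔ G.dist y z = i - 1 by omega]
  have hp : xPlus G x y = ∑ z ∈ Sp, Pi.single z 1 := by rw [xPlus, hSp, meet, hxy]
  have hs : ∀ w : X, (Pi.single w 1 : X → ℝ) = ∑ z ∈ {w}, Pi.single z 1 := fun w => by simp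
  have dot : ∀ S T : Finset X, ((F 1 *ᵥ ∑ z ∈ S, Pi.single z 1) ⬝ᵥ
      (F 1 *ᵥ ∑ t ∈ T, Pi.single t 1)) = n⁻¹ * ∑ z ∈ S, ∑ t ∈ T, θ (G.dist z t) := by
    intro S T
    rw [hF.1.mulVec_dotProduct, Finset.mul_sum]
    refine Finset.sum_congr rfl fun z _ => ?_
    rw [Finset.mul_sum]
    exact Finset.sum_congr rfl fun t _ => apply_eq_dualEigenvalue hE z t
  set em := F 1 *ᵥ xMinus G x y with hem
  set ep := F 1 *ᵥ xPlus G x y with hep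
  set ex := F 1 *ᵥ Pi.single x 1 with hex
  set ey := F 1 *ᵥ Pi.single y 1 with hey
  have gxx : ex ⬝ᵥ ex = n⁻¹ * θ 0 := by rw [hex, hs x, dot]; simp
  have gyy : ey ⬝ᵥ ey = n⁻¹ * θ 0 := by rw [hey, hs y, dot]; simp
  have gxy : ex ⬝ᵥ ey = n⁻¹ * θ i := by rw [hex, hey, hs x, hs y, dot]; simp [hxy]
  have single_sum : ∀ (S : Finset X) (w : X) (l : ℕ), (∀ z ∈ S, G.dist w z = l) →
      ((F 1 *ᵥ ∑ z ∈ S, Pi.single z 1) ⬝ᵥ (F 1 *ᵥ Pi.single w 1)) = n⁻¹ * (S.card * θ l) := by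
    intro S w l h
    rw [hs w, dot, ← nsmul_eq_mul, ← Finset.sum_const]
    congr 1
    refine Finset.sum_congr rfl fun z hz => ?_
    rw [Finset.sum_singleton, SimpleGraph.dist_comm, h z hz]
  have gmx : em ⬝ᵥ ex = n⁻¹ * (c * θ 1) := by
    rw [hem, hm, single_sum Sm x 1 (fun z hz => (mem_meet.1 hz).1), hcm]
  have gmy : em ⬝ᵥ ey = n⁻¹ * (c * θ (i - 1)) := by
    rw [hem, hm, single_sum Sm y (i - 1) (fun z hz => (mem_meet.1 hz).2), hcm]
  have gpx : ep ⬝ᵥ ex = n⁻¹ * (b * θ 1) := by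
    rw [hep, hp, single_sum Sp x 1 (fun z hz => (mem_meet.1 hz).1), hcp]
  have gpy : ep ⬝ᵥ ey = n⁻¹ * (b * θ (i + 1)) := by
    rw [hep, hp, single_sum Sp y (i + 1) (fun z hz => (mem_meet.1 hz).2), hcp]
  have gmm : em ⬝ᵥ em = n⁻¹ * (c * θ 0 + c * kiteNumber G i * (θ 1 - θ 2) + (c ^ 2 - c) * θ 2) := by
    rw [hem, hm, dot, sum_pairs_near hG.1 θ (fun z hz => (mem_meet.1 hz).1),
      sum_adjacent_pairs hG hR hxy (by omega), hcm, if_pos rfl, if_neg (by omega)]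
    ring
  have gpp : ep ⬝ᵥ ep = n⁻¹ * (b * θ 0 + b * (a₁ - kiteNumber G (i + 1)) * (θ 1 - θ 2) +
      (b ^ 2 - b) * θ 2) := by
    rw [hep, hp, dot, sum_pairs_near hG.1 θ (fun z hz => (mem_meet.1 hz).1),
      sum_adjacent_pairs hG hR hxy (by omega), hcp, if_pos rfl, if_neg (by omega)]
    ring
  have gmp : em ⬝ᵥ ep = n⁻¹ * (c * b * θ 2) := by
    rw [hem, hm, hep, hp, dot]
    -- `z` and `t` are both adjacent to `x`, and their distances to `y` differ by 2, so they are at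
    -- distance exactly 2.
    have : ∀ z ∈ Sm, ∑ t ∈ Sp, θ (G.dist z t) = b * θ 2 := by
      intro z hz
      rw [← hcp, ← nsmul_eq_mul, ← Finset.sum_const]
      refine Finset.sum_congr rfl fun t ht => ?_
      obtain ⟨h1, h2⟩ := mem_meet.1 hz
      obtain ⟨h3, h4⟩ := mem_meet.1 ht
      have h5 : G.dist z t ≤ G.dist z x + G.dist x t := hG.1.dist_triangle
      have h6 : G.dist y t ≤ G.dist y z + G.dist z t := hG.1.dist_triangle
      rw [SimpleGraph.dist_comm (u := z) (v := x)] at h5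
      rw [show G.dist z t = 2 by omega]
    rw [Finset.sum_congr rfl this, Finset.sum_const, nsmul_eq_mul, hcm]
    ring
  set r := rCoeff G (F 1) i with hr
  set s := sCoeff G (F 1) i with hs'
  set r' := bigRCoeff G (F 1) i with hr'
  set s' := bigSCoeff G (F 1) i with hs''
  have er : r * (θ 0 ^ 2 - θ i ^ 2) = c * (θ 0 * θ 1 - θ (i - 1) * θ i) := by
    rw [hr, rCoeff, mul_assoc, div_mul_cancel₀ _ hsq]
  have es : s * (θ 0 ^ 2 - θ i ^ 2) = c * (θ 0 * θ (i - 1) - θ 1 * θ i) := by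
    rw [hs', sCoeff, mul_assoc, div_mul_cancel₀ _ hsq]
  have er' : r' * (θ 0 ^ 2 - θ i ^ 2) = b * (θ 0 * θ 1 - θ (i + 1) * θ i) := by
    rw [hr', bigRCoeff, mul_assoc, div_mul_cancel₀ _ hsq]
  have es' : s' * (θ 0 ^ 2 - θ i ^ 2) = b * (θ 0 * θ (i + 1) - θ 1 * θ i) := by
    rw [hs'', bigSCoeff, mul_assoc, div_mul_cancel₀ _ hsq]
  -- `o1` to `o4` are the normal equations: `r, s` and `r', s'` are the coefficients of the
  -- orthogonal projections on the span of `E x̂, E ŷ`.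
  have o1 : c * θ 1 - r * θ 0 - s * θ i = 0 := by
    apply mul_left_cancel₀ hsq
    linear_combination -θ 0 * er - θ i * es
  have o2 : c * θ (i - 1) - r * θ i - s * θ 0 = 0 := by
    apply mul_left_cancel₀ hsq
    linear_combination -θ i * er - θ 0 * es
  have o3 : b * θ 1 - r' * θ 0 - s' * θ i = 0 := by
    apply mul_left_cancel₀ hsq
    linear_combination -θ 0 * er' - θ i * es'
  have o4 : b * θ (i + 1) - r' * θ i - s' * θ 0 = 0 := by
    apply mul_left_cancel₀ hsq
    linear_combination -θ i * er' - θ 0 * es'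
  have cross := hF.cross_identity hD hG (show 1 ≤ i by omega) hiD
  simp only [← hθ] at cross
  have gyx : ey ⬝ᵥ ex = n⁻¹ * θ i := by rw [dotProduct_comm, gxy]
  have gxm : ex ⬝ᵥ em = n⁻¹ * (c * θ 1) := by rw [dotProduct_comm, gmx]
  have gym : ey ⬝ᵥ em = n⁻¹ * (c * θ (i - 1)) := by rw [dotProduct_comm, gmy]
  have gxp : ex ⬝ᵥ ep = n⁻¹ * (b * θ 1) := by rw [dotProduct_comm, gpx]
  have gyp : ey ⬝ᵥ ep = n⁻¹ * (b * θ (i + 1)) := by rw [dotProduct_comm, gpy]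
  have hdep := not_linearIndependent_four_iff (u := em) (v := ep) (x := ex) (y := ey)
    (r := r) (s := s) (r' := r') (s' := s')
    (by simp only [sub_dotProduct, smul_dotProduct, smul_eq_mul, gmx, gxx, gyx]
        linear_combination n⁻¹ * o1)
    (by simp only [sub_dotProduct, smul_dotProduct, smul_eq_mul, gmy, gxy, gyy]
        linear_combination n⁻¹ * o2)
    (by simp only [sub_dotProduct, smul_dotProduct, smul_eq_mul, gpx, gxx, gyx]
        linear_combination n⁻¹ * o3)
    (by simp only [sub_dotProduct, smul_dotProduct, smul_eq_mul, gpy, gxy, gyy]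
        linear_combination n⁻¹ * o4)
    (by rw [gxx, gyy, gxy]
        have : n⁻¹ * θ 0 * (n⁻¹ * θ 0) - (n⁻¹ * θ i) ^ 2 = n⁻¹ ^ 2 * (θ 0 ^ 2 - θ i ^ 2) := by ring
        rw [this]
        exact mul_ne_zero (pow_ne_zero _ (inv_ne_zero hn)) hsq)
  have hnonneg := dotProduct_sq_le (em - r • ex - s • ey) (ep - r' • ex - s' • ey)
  have em_z : zMinus G (F 1) i * (θ 1 - θ 2) =
      r * θ 1 + s * θ (i - 1) - θ 0 - (c - 1) * θ 2 := by
    rw [zMinus, div_mul_cancel₀ _ h12]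
  have ep_z : zPlusSucc G (F 1) i * (θ 1 - θ 2) =
      θ 0 + a₁ * θ 1 + (b - 1 - a₁) * θ 2 - r' * θ 1 - s' * θ (i + 1) := by
    rw [zPlusSucc, div_mul_cancel₀ _ h12]
  set K := gammaStar G (F 1) / (θ 1 - θ 2) * ((θ i - θ 1) / (θ i + θ 0)) with hK
  have eK : θ 2 * b * c - r * b * θ 1 - s * b * θ (i + 1) = c * b * (θ 1 - θ 2) * K := by
    have hK2 : K * (θ 1 - θ 2) * (θ i + θ 0) = gammaStar G (F 1) * (θ i - θ 1) := by
      rw [hK]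
      field_simp
    apply mul_left_cancel₀ hsq
    linear_combination (-b * θ 1) * er - (b * θ (i + 1)) * es + (b * c) * cross -
      (b * c * (θ 0 - θ i)) * hK2
  have hP : (em - r • ex - s • ey) ⬝ᵥ (em - r • ex - s • ey) =
      n⁻¹ * (c * (θ 1 - θ 2) * (kiteNumber G i - zMinus G (F 1) i)) := by
    simp only [sub_dotProduct, dotProduct_sub, smul_dotProduct, dotProduct_smul, smul_eq_mul, gmm,
      gmx, gmy, gxx, gyy, gxy, gyx, gxm, gym]
    linear_combination n⁻¹ * c * em_z - n⁻¹ * r * o1 - n⁻¹ * s * o2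
  have hQ : (ep - r' • ex - s' • ey) ⬝ᵥ (ep - r' • ex - s' • ey) =
      n⁻¹ * (b * (θ 1 - θ 2) * (zPlusSucc G (F 1) i - kiteNumber G (i + 1))) := by
    simp only [sub_dotProduct, dotProduct_sub, smul_dotProduct, dotProduct_smul, smul_eq_mul, gpp,
      gpx, gpy, gxx, gyy, gxy, gyx, gxp, gyp]
    linear_combination -n⁻¹ * b * ep_z - n⁻¹ * r' * o3 - n⁻¹ * s' * o4
  have hC : (em - r • ex - s • ey) ⬝ᵥ (ep - r' • ex - s' • ey) =
      n⁻¹ * (c * b * (θ 1 - θ 2) * K) := by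
    simp only [sub_dotProduct, dotProduct_sub, smul_dotProduct, dotProduct_smul, smul_eq_mul, gmp,
      gmx, gmy, gxx, gyy, gxy, gyx, gxp, gyp]
    linear_combination n⁻¹ * eK - n⁻¹ * r' * o1 - n⁻¹ * s' * o2
  have hPhi : (Phi G (F 1) i).eval (kiteNumber G 2) =
      (kiteNumber G i - zMinus G (F 1) i) * (zPlusSucc G (F 1) i - kiteNumber G (i + 1)) -
        c * b * K ^ 2 := by
    rw [hF.kiteNumber_eq hD hG hR (show 1 ≤ i by omega) (by omega),
      hF.kiteNumber_eq hD hG hR (show 1 ≤ i + 1 by omega) hiD]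
    simp only [Phi, Polynomial.eval_add, Polynomial.eval_mul, Polynomial.eval_C,
      Polynomial.eval_pow, Polynomial.eval_X, uCoeff, vCoeff, wCoeff, ← hθ, ← hc, ← hb, ← ha₁, ← hK]
    ring
  -- The factor `θ 1 - θ 2` occurs squared, so its sign is irrelevant.
  set t := n⁻¹ ^ 2 * (c * b * (θ 1 - θ 2) ^ 2) with ht
  have htpos : 0 < t := by positivity
  have hdet : ((em - r • ex - s • ey) ⬝ᵥ (em - r • ex - s • ey)) *
      ((ep - r' • ex - s' • ey) ⬝ᵥ (ep - r' • ex - s' • ey)) -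
      ((em - r • ex - s • ey) ⬝ᵥ (ep - r' • ex - s' • ey)) ^ 2 =
        t * (Phi G (F 1) i).eval (kiteNumber G 2) := by
    rw [hP, hQ, hC, hPhi, ht]
    ring
  rw [hdet] at hdep hnonneg
  refine ⟨nonneg_of_mul_nonneg_right hnonneg htpos, ?_⟩
  rw [FourDependent, hdep, mul_eq_zero, or_iff_right htpos.ne']

end Main

end DistanceRegular

theorem mainTheorem5 {X : Type*} [Fintype X] [DecidableEq X] (G : SimpleGraph X)
    (hG : DistanceRegular.IsDistanceRegular G) (hD : 3 ≤ G.diam)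
    (hk : 3 ≤ DistanceRegular.kNum G 1)
    (E : Matrix X X ℝ) (hE : DistanceRegular.IsQPolynomialIdempotent G E)
    (hR : DistanceRegular.IsReinforced G)
    (i : ℕ) (hi : 2 ≤ i) (hiD : i + 1 ≤ G.diam) :
    0 ≤ (DistanceRegular.Phi G E i).eval (DistanceRegular.kiteNumber G 2) ∧
      List.TFAE [
        (DistanceRegular.Phi G E i).eval (DistanceRegular.kiteNumber G 2) = 0,
        ∀ x y : X, G.dist x y = i → DistanceRegular.FourDependent G E x y,
        ∃ x y : X, G.dist x y = i ∧ DistanceRegular.FourDependent G E x y] := by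
  obtain ⟨F, hF, rfl⟩ := hE
  have key := fun {x y : X} => hF.Phi_nonneg_and hD hG hR hi hiD (x := x) (y := y)
  -- An actual pair at distance `i` is needed for the inequality and for passing from all pairs to
  -- some pair.
  obtain ⟨x, y, hxy⟩ := DistanceRegular.exists_dist_eq hG.1 (show i ≤ G.diam by omega)
  refine ⟨(key hxy).1, ?_⟩
  tfae_have 1 → 2 := fun h u v huv => (key huv).2.2 h
  tfae_have 2 → 3 := fun h => ⟨x, y, hxy, h x y hxy⟩
  tfae_have 3 → 1 := fun ⟨u, v, huv, h⟩ => (key huv).2.1 h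
  tfae_finish
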